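/- Let $p>1$ and $a,b,L>0$, and write $s^{\pm}=\max\{\pm s,0\}$. The elements of $W^{1,p}_0(0,L)$ are identified with their continuous representatives on $[0,L]$. A real number $\lambda$ is a Dirichlet eigenvalue of the asymmetric $p$-Laplacian $-\Delta^{a,b}_p u=-\bigl(a^p[(u')^+]^{p-1}-b^p[(u')^-]^{p-1}\bigr)'$ on $(0,L)$, with eigenfunction $u$, if $u\in W^{1,p}_0(0,L)$, $u\not\equiv 0$, and $$\int_0^L\bigl(a^p[(u')^+]^{p-1}-b^p[(u')^-]^{p-1}\bigr)\varphi'\,dt=\lambda\int_0^L|u|^{p-2}u\,\varphi\,dt\qquad\text{for all }\varphi\in W^{1,p}_0(0,L).$$ Put $$\lambda^{a,b}_{1,p}(0,L)=\inf\Bigl\{\int_0^L a^p[(u')^+]^p+b^p[(u')^-]^p\,dt:\ u\in W^{1,p}_0(0,L),\ \|u\|_p=1\Bigr\},$$ and let $\lambda_{1,p}(0,L)=\inf\{\int_0^L|u'|^p\,dt:\ u\in W^{1,p}_0(0,L),\ \|u\|_p=1\}$ be the first Dirichlet eigenvalue of the classical operator $-\Delta_p u=-(|u'|^{p-2}u')'$;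 it equals $(p-1)(\pi_p/L)^p$ with $\pi_p=2\int_0^1(1-t^p)^{-1/p}\,dt$. There is exactly one eigenfunction $\varphi_p\in W^{1,p}_0(0,1)$ of $-\Delta_p$ associated to $\lambda_{1,p}(0,1)$ with $\varphi_p>0$ in $(0,1)$ and $\|\varphi_p\|_p=1$. Let $t_0=\frac{a}{a+b}$ and define on $[0,1]$ $$\varphi_p^{a,b,+}(t)=\begin{cases}\varphi_p\bigl(\tfrac{t}{2t_0}\bigr), & t<t_0,\\[2pt] \varphi_p\bigl(\tfrac{t+1-2t_0}{2(1-t_0)}\bigr), & t\ge t_0,\end{cases}\qquad \varphi_p^{a,b,-}(t)=\begin{cases}-\varphi_p\bigl(\tfrac{t}{2(1-t_0)}\bigr), & t<1-t_0,\\[2pt] -\varphi_p\bigl(\tfrac{t+2t_0-1}{2t_0}\bigr), & t\ge 1-t_0.\end{cases}$$ Then: (I) $\lambda^{a,b}_{1,p}(0,L)$ is the smallest Dirichlet eigenvalue of $-\Delta^{a,b}_p$ on $(0,L)$, and $\lambda^{a,b}_{1,p}(0,L)=\bigl(\frac{a+b}{2}\bigr)^p\lambda_{1,p}(0,L)$.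 (II) A function $u$ is an eigenfunction of $-\Delta^{a,b}_p$ associated to $\lambda^{a,b}_{1,p}(0,L)$ if and only if there is a constant $c>0$ such that either $u(t)=c\,\varphi_p^{a,b,+}(t/L)$ for all $t\in[0,L]$ or $u(t)=c\,\varphi_p^{a,b,-}(t/L)$ for all $t\in[0,L]$. In particular, if $a\ne b$, then $\lambda^{a,b}_{1,p}(0,L)$ is simple in the generalized sense: the set of its eigenfunctions is the union of two non-collinear half-lines in $C^1[0,L]$, one generated by a function positive in $(0,L)$ and the other by a function negative in $(0,L)$. The set of its eigenfunctions is formed by two collinear half-lines in $C^1[0,L]$ if and only if $a=b$, equivalently, if and only if $\Delta^{a,b}_p$ is a constant multiple of $\Delta_p$ as an operator on $W^{1,p}_0(0,L)$. -/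

import Mathlib

open MeasureTheory Set
open scoped ContDiff

namespace AsymPLaplace

/-- A smooth function compactly supported in the open interval `(0, L)`. -/
def IsTestFunction (L : ℝ) (η : ℝ → ℝ) : Prop :=
  ContDiff ℝ ∞ η ∧ HasCompactSupport η ∧ tsupport η ⊆ Ioo 0 L

/-- `u` is (the continuous representative of) an element of `W₀^{1,p}(0, L)`, and `v` is (a version
of) its weak derivative. In dimension one every element of `W^{1,p}(0, L)` has exactly one
representative that is continuous on `[0, L]`, and it belongs to `W₀^{1,p}(0, L)` iff that
representative vanishes at both endpoints. The values of `u` off `[0, L]` play no role.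
That `u` is in `L^p(0, L)` is automatic from continuity on `[0, L]`. -/
structure MemW₀ (p L : ℝ) (u v : ℝ → ℝ) : Prop where
  continuousOn : ContinuousOn u (Icc 0 L)
  left : u 0 = 0
  right : u L = 0
  memLp_deriv : MemLp v (ENNReal.ofReal p) (volume.restrict (Ioo 0 L))
  weak_deriv : ∀ η : ℝ → ℝ, IsTestFunction L η →
    ∫ t in Ioo 0 L, u t * deriv η t = -∫ t in Ioo 0 L, v t * η t

/-- The `L^p(0, L)` norm. -/
noncomputable def pNorm (p L : ℝ) (u : ℝ → ℝ) : ℝ :=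
  (∫ t in Ioo 0 L, |u t| ^ p) ^ (1 / p)

/-- `s ↦ a^p (s⁺)^(p-1) - b^p (s⁻)^(p-1)`. -/
noncomputable def flux (p a b s : ℝ) : ℝ :=
  a ^ p * (max s 0) ^ (p - 1) - b ^ p * (max (-s) 0) ^ (p - 1)

/-- `s ↦ |s|^(p-2) s`. -/
noncomputable def classicalFlux (p s : ℝ) : ℝ := |s| ^ (p - 2) * s

/-- `u ∈ W₀^{1,p}(0, L)` is a nontrivial weak solution of `-Δ_p^{a,b} u = lam |u|^(p-2) u`. -/
def IsEigenfunction (p a b L lam : ℝ) (u : ℝ → ℝ) : Prop :=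
  (∃ t ∈ Icc 0 L, u t ≠ 0) ∧
  ∃ v : ℝ → ℝ, MemW₀ p L u v ∧
    ∀ φ ψ : ℝ → ℝ, MemW₀ p L φ ψ →
      ∫ t in Ioo 0 L, flux p a b (v t) * ψ t =
        lam * ∫ t in Ioo 0 L, |u t| ^ (p - 2) * u t * φ t

/-- The Dirichlet spectrum of `-Δ_p^{a,b}` on `(0, L)`. -/
def dirichletSpectrum (p a b L : ℝ) : Set ℝ :=
  {lam | ∃ u : ℝ → ℝ, IsEigenfunction p a b L lam u}

/-- `λ_{1,p}^{a,b}(0, L)`: the infimum of the asymmetric energy over the unit sphere of `L^p` in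
`W₀^{1,p}(0, L)`. -/
noncomputable def firstEigenvalue (p a b L : ℝ) : ℝ :=
  sInf {r | ∃ u v : ℝ → ℝ, MemW₀ p L u v ∧ pNorm p L u = 1 ∧
    r = ∫ t in Ioo 0 L, (a ^ p * (max (v t) 0) ^ p + b ^ p * (max (-v t) 0) ^ p)}

/-- `u ∈ W₀^{1,p}(0, L)` is a nontrivial weak solution of `-(|u'|^(p-2) u')' = lam |u|^(p-2) u`. -/
def IsClassicalEigenfunction (p L lam : ℝ) (u : ℝ → ℝ) : Prop :=
  (∃ t ∈ Icc 0 L, u t ≠ 0) ∧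
  ∃ v : ℝ → ℝ, MemW₀ p L u v ∧
    ∀ φ ψ : ℝ → ℝ, MemW₀ p L φ ψ →
      ∫ t in Ioo 0 L, classicalFlux p (v t) * ψ t =
        lam * ∫ t in Ioo 0 L, |u t| ^ (p - 2) * u t * φ t

/-- `λ_{1,p}(0, L)`, the first Dirichlet eigenvalue of the classical `-Δ_p`. -/
noncomputable def classicalFirstEigenvalue (p L : ℝ) : ℝ :=
  sInf {r | ∃ u v : ℝ → ℝ, MemW₀ p L u v ∧ pNorm p L u = 1 ∧ r = ∫ t in Ioo 0 L, |v t| ^ p}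

/-- `π_p = 2 ∫_0^1 (1 - t^p)^(-1/p) dt`. -/
noncomputable def piP (p : ℝ) : ℝ := 2 * ∫ t in (0 : ℝ)..1, (1 - t ^ p) ^ (-1 / p)

/-- `φ` is the positive eigenfunction of `-Δ_p` on `(0, 1)` for `λ_{1,p}(0, 1)`, normalized in
`L^p(0, 1)`. -/
def IsPrincipalEigenfunction (p : ℝ) (φ : ℝ → ℝ) : Prop :=
  IsClassicalEigenfunction p 1 (classicalFirstEigenvalue p 1) φ ∧
  (∀ t ∈ Ioo (0 : ℝ) 1, 0 < φ t) ∧ pNorm p 1 φ = 1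

/-- The gluing point `t₀ = a / (a + b)`. -/
noncomputable def gluePoint (a b : ℝ) : ℝ := a / (a + b)

/-- `φ_p^{a,b,+}` on `[0, 1]`, built from `φ = φ_p`. -/
noncomputable def phiPlus (a b : ℝ) (φ : ℝ → ℝ) (t : ℝ) : ℝ :=
  if t < gluePoint a b then φ (t / (2 * gluePoint a b))
  else φ ((t + 1 - 2 * gluePoint a b) / (2 * (1 - gluePoint a b)))

/-- `φ_p^{a,b,-}` on `[0, 1]`, built from `φ = φ_p`. -/
noncomputable def phiMinus (a b : ℝ) (φ : ℝ → ℝ) (t : ℝ) : ℝ :=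
  if t < 1 - gluePoint a b then -φ (t / (2 * (1 - gluePoint a b)))
  else -φ ((t + 2 * gluePoint a b - 1) / (2 * gluePoint a b))

/-- The space `C¹[0, L]`, inside all real functions on `[0, L]`. -/
def C1 (L : ℝ) : Set (Icc (0 : ℝ) L → ℝ) :=
  {f | ∃ F : ℝ → ℝ, ContDiffOn ℝ 1 F (Icc 0 L) ∧ f = (Icc 0 L).domRestrict F}

/-- The set of eigenfunctions of `-Δ_p^{a,b}` for `lam`, as functions on `[0, L]`. -/
def eigenSet (p a b L lam : ℝ) : Set (Icc (0 : ℝ) L → ℝ) :=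
  {f | ∃ u : ℝ → ℝ, IsEigenfunction p a b L lam u ∧ f = (Icc 0 L).domRestrict u}

/-- The open half-line generated by `f`. -/
def halfLine {L : ℝ} (f : Icc (0 : ℝ) L → ℝ) : Set (Icc (0 : ℝ) L → ℝ) :=
  {g | ∃ c : ℝ, 0 < c ∧ g = c • f}

/-- Simplicity in the generalized sense (for `a ≠ b`): the eigenfunctions form two non-collinear
half-lines in `C¹[0, L]`, one generated by a function that is positive in `(0, L)`, the other by a
function that is negative in `(0, L)`. -/
def IsSimpleGeneralized (p a b L lam : ℝ) : Prop :=
  ∃ f ∈ C1 L, ∃ g ∈ C1 L,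
    (∀ t : Icc (0 : ℝ) L, (t : ℝ) ∈ Ioo 0 L → 0 < f t) ∧
    (∀ t : Icc (0 : ℝ) L, (t : ℝ) ∈ Ioo 0 L → g t < 0) ∧
    eigenSet p a b L lam = halfLine f ∪ halfLine g ∧
    ¬ Collinear ℝ (halfLine f ∪ halfLine g)

/-- The eigenfunctions form two distinct half-lines in `C¹[0, L]` lying on a common line. -/
def IsTwoCollinearHalfLines (p a b L lam : ℝ) : Prop :=
  ∃ f ∈ C1 L, ∃ g ∈ C1 L, f ≠ 0 ∧ g ≠ 0 ∧ halfLine f ≠ halfLine g ∧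
    eigenSet p a b L lam = halfLine f ∪ halfLine g ∧
    Collinear ℝ (halfLine f ∪ halfLine g)

/-- `Δ_p^{a,b}` is a constant multiple of the classical `Δ_p`, as operators from `W₀^{1,p}(0, L)`
to its dual. -/
def IsMultipleOfClassical (p a b L : ℝ) : Prop :=
  ∃ k : ℝ, ∀ u v φ ψ : ℝ → ℝ, MemW₀ p L u v → MemW₀ p L φ ψ →
    ∫ t in Ioo 0 L, flux p a b (v t) * ψ t = k * ∫ t in Ioo 0 L, classicalFlux p (v t) * ψ t

end AsymPLaplace

open AsymPLaplace

/-! A positive solution can be written down explicitly. On an increasing branch the equation is the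
classical one with weight `a ^ p`, on a decreasing branch with weight `b ^ p`, so each branch is a
rescaled quarter period of the generalized sine. If the rising and falling branches use frequencies
`α` and `β`, both produce the same eigenvalue exactly when `a * α = b * β = μ`, and that eigenvalue
is `(p - 1) * μ ^ p`. The branch lengths are then proportional to `a` and `b`, which locates the
maximum at `L * a / (a + b)`; fitting the interval forces `μ = (π_p / 2) * (a + b) / L`. This is
`isProfile_profile`.

Minimality comes from a Picone-type calibration. For a positive solution `φ`, the derivative of
`(u⁺)^p φ^(1-p) flux(φ')` is bounded almost everywhere on `{u > 0}` by the energy density of `u'`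
minus `lam * (u⁺)^p`, and it vanishes on `{u ≤ 0}`. Its boundary values tend to zero, so integration
yields the eigenvalue inequality for `u⁺`, with equality only if `u⁺` is a multiple of `φ`
(`calibration_bound`). Applying this to `u` and, with `a` and `b` exchanged, to `-u` gives the sharp
bound for `u`. In the equality case `φ > 0` excludes a change of sign, so `u` lies on one of two
half-lines (`lam_mul_integral_le_energy`).

An eigenfunction tested against itself has Rayleigh quotient equal to its eigenvalue. Hence no
eigenvalue is smaller than `lam`, and eigenfunctions for `lam` are precisely the equality cases.
Collinearity of the half-lines is decided by the positions of the two maxima, and proportionality of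
the operators by two piecewise linear test functions. -/

namespace AsymPLaplace

/-! ### Generalized arcsine and generalized sine -/

/-- The derivative of the generalized arcsine, extended by `1` off `(0, 1)`. -/
noncomputable def arcsinDeriv (p t : ℝ) : ℝ :=
  if t < 1 then (1 - (max t 0) ^ p) ^ (-1 / p) else 1

/-- The generalized arcsine, extended to an increasing bijection of `ℝ`. -/
noncomputable def arcsinP (p x : ℝ) : ℝ := ∫ t in (0 : ℝ)..x, arcsinDeriv p t

lemma rpow_max_lt_one {p t : ℝ} (hp : 1 < p) (ht : t < 1) : (max t 0) ^ p < 1 :=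
  Real.rpow_lt_one (le_max_right _ _) (max_lt ht one_pos) (by linarith)

lemma one_le_arcsinDeriv {p : ℝ} (hp : 1 < p) (t : ℝ) : 1 ≤ arcsinDeriv p t := by
  unfold arcsinDeriv
  split_ifs with h
  · refine Real.one_le_rpow_of_pos_of_le_one_of_nonpos ?_ ?_ ?_
    · linarith [rpow_max_lt_one hp h]
    · linarith [Real.rpow_nonneg (le_max_right t 0) p]
    · exact div_nonpos_of_nonpos_of_nonneg (by norm_num) (by linarith)
  · exact le_rfl

lemma arcsinDeriv_of_nonpos {p t : ℝ} (hp : 1 < p) (ht : t ≤ 0) : arcsinDeriv p t = 1 := by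
  unfold arcsinDeriv
  rw [if_pos (by linarith), max_eq_right ht, Real.zero_rpow (by linarith)]
  simp

lemma measurable_arcsinDeriv (p : ℝ) : Measurable (arcsinDeriv p) := by
  unfold arcsinDeriv
  refine Measurable.ite measurableSet_Iio ?_ measurable_const
  fun_prop

lemma continuousAt_arcsinDeriv {p t : ℝ} (hp : 1 < p) (ht : t < 1) :
    ContinuousAt (arcsinDeriv p) t := by
  have h : ContinuousAt (fun t : ℝ => (1 - (max t 0) ^ p) ^ (-1 / p)) t := by
    refine ContinuousAt.rpow_const ?_ (Or.inl ?_)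
    · refine continuousAt_const.sub (ContinuousAt.rpow_const (by fun_prop) (Or.inr (by linarith)))
    · linarith [rpow_max_lt_one hp ht]
  refine h.congr ?_
  filter_upwards [Iio_mem_nhds ht] with x hx
  simp only [arcsinDeriv]
  rw [if_pos (mem_Iio.1 hx)]

/-- Since `x ^ p ≤ x` on `(0, 1)`, the integrand is dominated by `(1 - x) ^ (-1 / p)`, which is
integrable because `1 / p < 1`. -/
lemma intervalIntegrable_arcsinDeriv_zero_one {p : ℝ} (hp : 1 < p) :
    IntervalIntegrable (arcsinDeriv p) volume 0 1 := by
  have h1 : IntervalIntegrable (fun x : ℝ => x ^ (-1 / p)) volume 0 1 := by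
    refine intervalIntegral.intervalIntegrable_rpow' ?_
    rw [lt_div_iff₀ (by linarith)]
    linarith
  have h2 := (h1.comp_sub_left 1).symm
  simp only [sub_zero, sub_self] at h2
  refine h2.mono_fun (measurable_arcsinDeriv p).aestronglyMeasurable ?_
  have hne : ∀ᵐ x : ℝ ∂(volume.restrict (uIoc (0 : ℝ) 1)), x ≠ 1 :=
    ae_restrict_of_ae (by simp [ae_iff, measure_singleton])
  filter_upwards [hne, ae_restrict_mem measurableSet_uIoc] with x hx1 hx
  rw [uIoc_of_le zero_le_one] at hx
  have hx1' : x < 1 := lt_of_le_of_ne hx.2 hx1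
  rw [Real.norm_of_nonneg (by linarith [one_le_arcsinDeriv hp x]),
    Real.norm_of_nonneg (Real.rpow_nonneg (by linarith) _)]
  unfold arcsinDeriv
  rw [if_pos hx1', max_eq_left hx.1.le]
  refine Real.rpow_le_rpow_of_nonpos (by linarith) ?_ ?_
  · have : x ^ p ≤ x ^ (1 : ℝ) := Real.rpow_le_rpow_of_exponent_ge hx.1 hx.2 hp.le
    rw [Real.rpow_one] at this
    linarith
  · exact div_nonpos_of_nonpos_of_nonneg (by norm_num) (by linarith)

lemma intervalIntegrable_arcsinDeriv {p : ℝ} (hp : 1 < p) (x y : ℝ) :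
    IntervalIntegrable (arcsinDeriv p) volume x y := by
  have key : ∀ x, IntervalIntegrable (arcsinDeriv p) volume 0 x := by
    intro x
    rcases le_total x 0 with hx | hx
    · refine (intervalIntegrable_const (c := (1 : ℝ))).congr fun t ht => ?_
      rw [uIoc_of_ge hx] at ht
      exact (arcsinDeriv_of_nonpos hp ht.2).symm
    · rcases le_total x 1 with hx1 | hx1
      · refine (intervalIntegrable_arcsinDeriv_zero_one hp).mono_set ?_
        rw [uIcc_of_le hx, uIcc_of_le zero_le_one]
        exact Icc_subset_Icc_right hx1
      · refine (intervalIntegrable_arcsinDeriv_zero_one hp).trans ?_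
        refine (intervalIntegrable_const (c := (1 : ℝ))).congr fun t ht => ?_
        rw [uIoc_of_le hx1] at ht
        simp only [arcsinDeriv]
        rw [if_neg (not_lt.2 ht.1.le)]
  exact (key x).symm.trans (key y)

lemma continuous_arcsinP {p : ℝ} (hp : 1 < p) : Continuous (arcsinP p) :=
  intervalIntegral.continuous_primitive (intervalIntegrable_arcsinDeriv hp) 0

/-- The integrand is at least `1`. This expansion estimate supplies both strict monotonicity and
surjectivity onto `ℝ`. -/
lemma sub_le_arcsinP_sub {p : ℝ} (hp : 1 < p) {x y : ℝ} (hxy : x ≤ y) :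
    y - x ≤ arcsinP p y - arcsinP p x := by
  unfold arcsinP
  rw [intervalIntegral.integral_interval_sub_left (intervalIntegrable_arcsinDeriv hp _ _)
    (intervalIntegrable_arcsinDeriv hp _ _)]
  have h := intervalIntegral.integral_mono_on hxy (intervalIntegrable_const (c := (1 : ℝ)))
    (intervalIntegrable_arcsinDeriv hp x y) (fun t _ => one_le_arcsinDeriv hp t)
  simpa using h

lemma arcsinP_zero (p : ℝ) : arcsinP p 0 = 0 := by simp [arcsinP]

lemma strictMono_arcsinP {p : ℝ} (hp : 1 < p) : StrictMono (arcsinP p) := fun x y hxy => by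
  linarith [sub_le_arcsinP_sub hp hxy.le]

lemma surjective_arcsinP {p : ℝ} (hp : 1 < p) : Function.Surjective (arcsinP p) := by
  refine (continuous_arcsinP hp).surjective ?_ ?_
  · refine Filter.tendsto_atTop_mono' _ ?_ Filter.tendsto_id
    filter_upwards [Filter.eventually_ge_atTop 0] with x hx
    have := sub_le_arcsinP_sub hp hx
    rw [arcsinP_zero] at this
    simpa using this
  · refine Filter.tendsto_atBot_mono' _ ?_ Filter.tendsto_id
    filter_upwards [Filter.eventually_le_atBot 0] with x hx
    have := sub_le_arcsinP_sub hp hx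
    rw [arcsinP_zero] at this
    simpa using this

lemma piP_eq {p : ℝ} : piP p = 2 * arcsinP p 1 := by
  unfold piP arcsinP
  congr 1
  refine intervalIntegral.integral_congr_ae ?_
  have hne : ∀ᵐ x : ℝ, x ≠ 1 := by simp [ae_iff, measure_singleton]
  filter_upwards [hne] with x hx1 hx
  rw [uIoc_of_le zero_le_one] at hx
  simp only [arcsinDeriv]
  rw [if_pos (lt_of_le_of_ne hx.2 hx1), max_eq_left hx.1.le]

lemma piP_pos {p : ℝ} (hp : 1 < p) : 0 < piP p := by
  have := strictMono_arcsinP hp one_pos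
  rw [arcsinP_zero] at this
  rw [piP_eq]
  linarith

/-- The corner at `0` is harmless for `1 < p`: the candidate derivative is continuous there, so
differentiability extends from the punctured line. -/
lemma hasDerivAt_max_rpow {p : ℝ} (hp : 1 < p) (x : ℝ) :
    HasDerivAt (fun x : ℝ => (max x 0) ^ p) (p * (max x 0) ^ (p - 1)) x := by
  refine hasDerivAt_of_hasDerivAt_of_ne' (x := 0) (g := fun x => p * (max x 0) ^ (p - 1))
    ?_ ?_ ?_ x
  · intro y hy
    rcases lt_or_gt_of_ne hy with h | h
    · rw [max_eq_right h.le, Real.zero_rpow (by linarith), mul_zero]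
      refine (hasDerivAt_const y (0 : ℝ)).congr_of_eventuallyEq ?_
      filter_upwards [Iio_mem_nhds h] with z hz
      rw [max_eq_right (le_of_lt hz), Real.zero_rpow (by linarith)]
    · rw [max_eq_left h.le]
      refine (Real.hasDerivAt_rpow_const (Or.inl h.ne')).congr_of_eventuallyEq ?_
      filter_upwards [Ioi_mem_nhds h] with z hz
      rw [max_eq_left (le_of_lt hz)]
  · exact (Continuous.rpow_const (by fun_prop) fun _ => Or.inr (by linarith)).continuousAt
  · exact (continuous_const.mul
      (Continuous.rpow_const (by fun_prop) fun _ => Or.inr (by linarith))).continuousAt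

/-- `S` is a generalized sine with derivative `C`: it increases along the first quarter period and
is continued by the constant `1`. -/
structure IsSinP (p : ℝ) (S C : ℝ → ℝ) : Prop where
  hasDerivAt : ∀ t, HasDerivAt S (C t) t
  continuous_deriv : Continuous C
  deriv_pos : ∀ t < piP p / 2, 0 < C t
  deriv_eq_zero : ∀ t, piP p / 2 ≤ t → C t = 0
  eq_one : ∀ t, piP p / 2 ≤ t → S t = 1
  lt_one : ∀ t < piP p / 2, S t < 1
  zero : S 0 = 0
  pos : ∀ t > 0, 0 < S t
  hasDerivAt_rpow : ∀ t < piP p / 2,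
    HasDerivAt (fun s => C s ^ (p - 1)) (-(p - 1) * (max (S t) 0) ^ (p - 1)) t

/-- `S` is the inverse of the arcsine truncated at `1`, and `C` is defined by the Pythagorean
identity `C ^ p + (S⁺) ^ p = 1`. Continuing `S` by a constant lets two branches be glued later by
mere addition. -/
theorem exists_isSinP {p : ℝ} (hp : 1 < p) : ∃ S C : ℝ → ℝ, IsSinP p S C := by
  have hp0 : 0 < p := by linarith
  set q := piP p / 2 with hq
  have hAq : arcsinP p 1 = q := by rw [hq, piP_eq]; ring
  let e := (strictMono_arcsinP hp).orderIsoOfSurjective _ (surjective_arcsinP hp)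
  have he : ∀ x, e x = arcsinP p x := fun x => rfl
  have hA : ∀ t, arcsinP p (e.symm t) = t := fun t => by rw [← he]; exact e.apply_symm_apply t
  have heq : e.symm q = 1 := by rw [← hAq, ← he]; exact e.symm_apply_apply 1
  have he0 : e.symm 0 = 0 := by
    have := e.symm_apply_apply 0
    rwa [he, arcsinP_zero] at this
  have hecont : Continuous e.symm := e.symm.continuous
  have helt : ∀ t < q, e.symm t < 1 := fun t ht => by
    rw [← heq]; exact e.symm.strictMono ht
  have hele : ∀ t, q ≤ t → 1 ≤ e.symm t := fun t ht => by
    rw [← heq]; exact e.symm.monotone ht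
  have hqpos : 0 < q := by have := piP_pos hp; positivity
  let S : ℝ → ℝ := fun t => min (e.symm t) 1
  let C : ℝ → ℝ := fun t => (1 - (max (S t) 0) ^ p) ^ (1 / p)
  have hSlt : ∀ t < q, S t = e.symm t := fun t ht => min_eq_left (helt t ht).le
  have hSge : ∀ t, q ≤ t → S t = 1 := fun t ht => min_eq_right (hele t ht)
  have hSev : ∀ t < q, S =ᶠ[nhds t] e.symm := fun t ht => by
    filter_upwards [Iio_mem_nhds ht] with x hx using hSlt x hx
  have hScont : Continuous S := hecont.min continuous_const
  have hCcont : Continuous C := by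
    refine Continuous.rpow_const ?_ fun _ => Or.inr (by positivity)
    exact continuous_const.sub
      (Continuous.rpow_const (hScont.max continuous_const) fun _ => Or.inr hp0.le)
  have hCge : ∀ t, q ≤ t → C t = 0 := fun t ht => by
    simp only [C, hSge t ht]
    rw [max_eq_left zero_le_one, Real.one_rpow, sub_self, Real.zero_rpow (by positivity)]
  have hCpos : ∀ t < q, 0 < C t := fun t ht => by
    refine Real.rpow_pos_of_pos ?_ _
    rw [hSlt t ht]
    linarith [rpow_max_lt_one hp (helt t ht)]
  have hSd : ∀ t, HasDerivAt S (C t) t := by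
    -- At the quarter period the arcsine has infinite slope, so the inverse function rule fails; the
    -- derivative there is the limit of nearby derivatives.
    refine hasDerivAt_of_hasDerivAt_of_ne' (x := q) ?_ hScont.continuousAt hCcont.continuousAt
    intro t ht
    rcases lt_or_gt_of_ne ht with h | h
    · have h1 : HasDerivAt (arcsinP p) (arcsinDeriv p (e.symm t)) (e.symm t) :=
        intervalIntegral.integral_hasDerivAt_right (intervalIntegrable_arcsinDeriv hp _ _)
          (measurable_arcsinDeriv p).stronglyMeasurable.stronglyMeasurableAtFilter
          (continuousAt_arcsinDeriv hp (helt t h))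
      have h2 : HasDerivAt e.symm (arcsinDeriv p (e.symm t))⁻¹ t := by
        refine HasDerivAt.of_local_left_inverse hecont.continuousAt h1 ?_ ?_
        · linarith [one_le_arcsinDeriv hp (e.symm t)]
        · exact Filter.Eventually.of_forall hA
      refine (h2.congr_of_eventuallyEq (hSev t h)).congr_deriv ?_
      simp only [C, hSlt t h, arcsinDeriv]
      rw [if_pos (helt t h), ← Real.rpow_neg]
      · congr 1; ring
      · linarith [rpow_max_lt_one hp (helt t h)]
    · rw [hCge t h.le]
      refine (hasDerivAt_const t (1 : ℝ)).congr_of_eventuallyEq ?_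
      filter_upwards [Ioi_mem_nhds h] with x hx using hSge x (le_of_lt hx)
  refine ⟨S, C, hSd, hCcont, hCpos, hCge, hSge, fun t ht => ?_, ?_, fun t ht => ?_, ?_⟩
  · rw [hSlt t ht]; exact helt t ht
  · rw [hSlt 0 hqpos, he0]
  · refine lt_min ?_ one_pos
    rw [← he0]; exact e.symm.strictMono ht
  · intro t ht
    have hbase : 0 < 1 - (max (S t) 0) ^ p := by
      rw [hSlt t ht]
      linarith [rpow_max_lt_one hp (helt t ht)]
    have hf : (fun s => C s ^ (p - 1)) = fun s => (1 - (max (S s) 0) ^ p) ^ ((p - 1) / p) := by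
      funext s
      have : 0 ≤ 1 - (max (S s) 0) ^ p := by
        have := Real.rpow_le_one (le_max_right (S s) 0) (max_le (min_le_right _ _) zero_le_one)
          hp0.le
        linarith
      simp only [C]
      rw [← Real.rpow_mul this]
      congr 1
      ring
    rw [hf]
    have h := (((hasDerivAt_max_rpow hp (S t)).comp t (hSd t)).const_sub 1).rpow_const
      (p := (p - 1) / p) (Or.inl hbase.ne')
    refine h.congr_deriv ?_
    simp only [C, Function.comp]
    set B := 1 - (max (S t) 0) ^ p
    -- `B ^ (1 / p)` is the factor `S'`; it cancels the `B ^ (-1 / p)` left by the power rule.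
    have : B ^ (1 / p) * B ^ ((p - 1) / p - 1) = 1 := by
      rw [← Real.rpow_add hbase]
      have : 1 / p + ((p - 1) / p - 1) = 0 := by field_simp; ring
      rw [this, Real.rpow_zero]
    calc _ = -(p * ((p - 1) / p) * (max (S t) 0) ^ (p - 1)) *
          (B ^ (1 / p) * B ^ ((p - 1) / p - 1)) := by ring
      _ = _ := by rw [this]; field_simp

/-! ### The explicit positive profile -/

/-- The closed form of the first eigenvalue. -/
noncomputable def lamValue (p a b L : ℝ) : ℝ := ((a + b) / 2) ^ p * ((p - 1) * (piP p / L) ^ p)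

/-- A positive solution, with derivative `V`, of the Dirichlet problem for `-Δ_p^{a,b}` in classical
form. -/
structure IsProfile (p a b L lam : ℝ) (φ V : ℝ → ℝ) : Prop where
  hasDerivAt : ∀ t, HasDerivAt φ (V t) t
  continuous_deriv : Continuous V
  left : φ 0 = 0
  right : φ L = 0
  pos : ∀ t ∈ Ioo 0 L, 0 < φ t
  deriv_left : 0 < V 0
  deriv_right : V L < 0
  hasDerivAt_flux : ∀ t, HasDerivAt (fun s => flux p a b (V s)) (-lam * (max (φ t) 0) ^ (p - 1)) t

/-- Two rescaled quarter periods of a generalized sine, glued at their maximum. -/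
noncomputable def profile (p a b L : ℝ) (S : ℝ → ℝ) (t : ℝ) : ℝ :=
  S (piP p / 2 * (a + b) / (a * L) * t) + S (piP p / 2 * (a + b) / (b * L) * (L - t)) - 1

/-- The derivative of `profile`. -/
noncomputable def profileDeriv (p a b L : ℝ) (C : ℝ → ℝ) (t : ℝ) : ℝ :=
  piP p / 2 * (a + b) / (a * L) * C (piP p / 2 * (a + b) / (a * L) * t) -
    piP p / 2 * (a + b) / (b * L) * C (piP p / 2 * (a + b) / (b * L) * (L - t))

lemma lamValue_eq {p a b L : ℝ} (hp : 1 < p) (ha : 0 < a) (hb : 0 < b) (hL : 0 < L) :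
    lamValue p a b L = (p - 1) * (piP p / 2 * (a + b) / L) ^ p := by
  have := piP_pos hp
  unfold lamValue
  have h : piP p / 2 * (a + b) / L = (a + b) / 2 * (piP p / L) := by ring
  rw [h, Real.mul_rpow (by positivity) (by positivity)]
  ring

lemma lamValue_comm (p a b L : ℝ) : lamValue p a b L = lamValue p b a L := by
  unfold lamValue
  rw [add_comm]

section

variable {p a b L : ℝ} {S C : ℝ → ℝ}

/-- Both arguments of `S` in `profile` reach the quarter period at `L * a / (a + b)`. On either side
of this point one summand is frozen at `1` and cancels the `-1`. -/
lemma lt_left_scale (hp : 1 < p) (ha : 0 < a) (hb : 0 < b) (hL : 0 < L) {t : ℝ} :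
    piP p / 2 * (a + b) / (a * L) * t < piP p / 2 ↔ t < L * a / (a + b) := by
  have := piP_pos hp
  have h : piP p / 2 * (a + b) / (a * L) * t = piP p / 2 * (t * (a + b) / (L * a)) := by
    field_simp
  rw [h, mul_lt_iff_lt_one_right (by positivity), div_lt_one (by positivity),
    lt_div_iff₀ (by positivity)]

lemma lt_right_scale (hp : 1 < p) (ha : 0 < a) (hb : 0 < b) (hL : 0 < L) {t : ℝ} :
    piP p / 2 * (a + b) / (b * L) * (L - t) < piP p / 2 ↔ L * a / (a + b) < t := by
  rw [add_comm a b, lt_left_scale hp hb ha hL, lt_div_iff₀ (by positivity),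
    div_lt_iff₀ (by positivity)]
  constructor <;> intro h <;> nlinarith

lemma profile_of_le (hp : 1 < p) (ha : 0 < a) (hb : 0 < b) (hL : 0 < L) (hS : IsSinP p S C)
    {t : ℝ} (ht : t ≤ L * a / (a + b)) :
    profile p a b L S t = S (piP p / 2 * (a + b) / (a * L) * t) := by
  unfold profile
  rw [hS.eq_one _ (not_lt.1 fun h => absurd ((lt_right_scale hp ha hb hL).1 h) (not_lt.2 ht))]
  ring

lemma profile_of_ge (hp : 1 < p) (ha : 0 < a) (hb : 0 < b) (hL : 0 < L) (hS : IsSinP p S C)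
    {t : ℝ} (ht : L * a / (a + b) ≤ t) :
    profile p a b L S t = S (piP p / 2 * (a + b) / (b * L) * (L - t)) := by
  unfold profile
  rw [hS.eq_one _ (not_lt.1 fun h => absurd ((lt_left_scale hp ha hb hL).1 h) (not_lt.2 ht))]
  ring

lemma profile_glue (hp : 1 < p) (ha : 0 < a) (hb : 0 < b) (hL : 0 < L) (hS : IsSinP p S C) :
    profile p a b L S (L * a / (a + b)) = 1 := by
  rw [profile_of_le hp ha hb hL hS le_rfl,
    hS.eq_one _ (not_lt.1 fun h => absurd ((lt_left_scale hp ha hb hL).1 h) (lt_irrefl _))]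

lemma profile_lt_one (hp : 1 < p) (ha : 0 < a) (hb : 0 < b) (hL : 0 < L) (hS : IsSinP p S C)
    {t : ℝ} (ht : t ≠ L * a / (a + b)) : profile p a b L S t < 1 := by
  rcases lt_or_gt_of_ne ht with h | h
  · rw [profile_of_le hp ha hb hL hS h.le]
    exact hS.lt_one _ ((lt_left_scale hp ha hb hL).2 h)
  · rw [profile_of_ge hp ha hb hL hS (le_of_lt h)]
    exact hS.lt_one _ ((lt_right_scale hp ha hb hL).2 h)

lemma glue_mem_Ioo (ha : 0 < a) (hb : 0 < b) (hL : 0 < L) : L * a / (a + b) ∈ Ioo 0 L := by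
  refine ⟨by positivity, ?_⟩
  rw [div_lt_iff₀ (by positivity)]
  nlinarith

lemma flux_of_nonneg {s : ℝ} (hp : 1 < p) (hs : 0 ≤ s) : flux p a b s = a ^ p * s ^ (p - 1) := by
  unfold flux
  rw [max_eq_left hs, max_eq_right (by linarith), Real.zero_rpow (by linarith)]
  ring

lemma flux_of_nonpos {s : ℝ} (hp : 1 < p) (hs : s ≤ 0) :
    flux p a b s = -(b ^ p * (-s) ^ (p - 1)) := by
  unfold flux
  rw [max_eq_right hs, max_eq_left (by linarith), Real.zero_rpow (by linarith)]
  ring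

lemma continuous_flux (hp : 1 < p) : Continuous (flux p a b) := by
  unfold flux
  have h : 0 ≤ p - 1 := by linarith
  refine (continuous_const.mul ?_).sub (continuous_const.mul ?_)
  · exact Continuous.rpow_const (by fun_prop) fun _ => Or.inr h
  · exact Continuous.rpow_const (by fun_prop) fun _ => Or.inr h

/-- Each branch solves its own classical equation, and the common value `a * α = b * β = μ` gives
both the eigenvalue `(p - 1) * μ ^ p`. -/
theorem isProfile_profile (hp : 1 < p) (ha : 0 < a) (hb : 0 < b) (hL : 0 < L)
    (hS : IsSinP p S C) :
    IsProfile p a b L (lamValue p a b L) (profile p a b L S) (profileDeriv p a b L C) := by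
  have hpi := piP_pos hp
  have hT := glue_mem_Ioo ha hb hL
  set T := L * a / (a + b) with hTdef
  set α := piP p / 2 * (a + b) / (a * L) with hα
  set β := piP p / 2 * (a + b) / (b * L) with hβ
  set μ := piP p / 2 * (a + b) / L with hμ
  have hαpos : 0 < α := by positivity
  have hβpos : 0 < β := by positivity
  have hμpos : 0 < μ := by positivity
  have hαμ : a * α = μ := by rw [hα, hμ]; field_simp
  have hβμ : b * β = μ := by rw [hβ, hμ]; field_simp
  have hlt1 : ∀ {t}, α * t < piP p / 2 ↔ t < T := lt_left_scale hp ha hb hL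
  have hlt2 : ∀ {t}, β * (L - t) < piP p / 2 ↔ T < t := lt_right_scale hp ha hb hL
  have hlam : lamValue p a b L = (p - 1) * μ ^ p := lamValue_eq hp ha hb hL
  have hVlt : ∀ t ≤ T, profileDeriv p a b L C t = α * C (α * t) := fun t ht => by
    unfold profileDeriv
    rw [hS.deriv_eq_zero (β * (L - t)) (not_lt.1 fun h => absurd (hlt2.1 h) (not_lt.2 ht))]
    ring
  have hVgt : ∀ t, T ≤ t → profileDeriv p a b L C t = -(β * C (β * (L - t))) := fun t ht => by
    unfold profileDeriv
    rw [hS.deriv_eq_zero (α * t) (not_lt.1 fun h => absurd (hlt1.1 h) (not_lt.2 ht))]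
    ring
  have hd : ∀ t, HasDerivAt (profile p a b L S) (profileDeriv p a b L C t) t := fun t => by
    have h1 : HasDerivAt (fun t => S (α * t)) (C (α * t) * (α * 1)) t :=
      (hS.hasDerivAt (α * t)).comp t ((hasDerivAt_id t).const_mul α)
    have h2 : HasDerivAt (fun t => S (β * (L - t))) (C (β * (L - t)) * (β * -1)) t :=
      (hS.hasDerivAt (β * (L - t))).comp t (((hasDerivAt_id t).const_sub L).const_mul β)
    refine ((h1.add h2).sub_const 1).congr_deriv ?_
    unfold profileDeriv
    ring
  have hC := hS.continuous_deriv
  have hVc : Continuous (profileDeriv p a b L C) := by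
    unfold profileDeriv
    fun_prop
  refine ⟨hd, hVc, ?_, ?_, ?_, ?_, ?_, ?_⟩
  · rw [profile_of_le hp ha hb hL hS hT.1.le, mul_zero, hS.zero]
  · rw [profile_of_ge hp ha hb hL hS hT.2.le, sub_self, mul_zero, hS.zero]
  · intro t ht
    rcases le_total t T with h | h
    · rw [profile_of_le hp ha hb hL hS h]
      exact hS.pos _ (mul_pos hαpos ht.1)
    · rw [profile_of_ge hp ha hb hL hS h]
      exact hS.pos _ (mul_pos hβpos (by linarith [ht.2]))
  · rw [hVlt 0 hT.1.le]
    exact mul_pos hαpos (hS.deriv_pos _ (hlt1.2 hT.1))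
  · rw [hVgt L hT.2.le]
    have := mul_pos hβpos (hS.deriv_pos _ (hlt2.2 hT.2))
    linarith
  · have hφc : Continuous (profile p a b L S) :=
      continuous_iff_continuousAt.2 fun t => (hd t).continuousAt
    -- At the maximum the flux and its proposed derivative are both continuous, so the equation
    -- carries over from the two open branches.
    refine hasDerivAt_of_hasDerivAt_of_ne' (x := T)
      (g := fun t => -lamValue p a b L * (max (profile p a b L S t) 0) ^ (p - 1)) ?_ ?_ ?_
    · intro t ht
      have key : ∀ x γ : ℝ, 0 < x → 0 < γ → x * γ = μ → x ^ p * γ ^ (p - 1) * γ = μ ^ p := by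
        intro x γ hx hγ h
        rw [mul_assoc, ← Real.rpow_add_one hγ.ne', sub_add_cancel, ← Real.mul_rpow hx.le hγ.le, h]
      have hCnn : ∀ s, 0 ≤ C s := fun s => by
        rcases lt_or_ge s (piP p / 2) with h | h
        · exact (hS.deriv_pos s h).le
        · exact (hS.deriv_eq_zero s h).ge
      rcases lt_or_gt_of_ne ht with h | h
      · have h1 : HasDerivAt (fun s => a ^ p * (α ^ (p - 1) * (fun s => C s ^ (p - 1)) (α * s)))
            (a ^ p * (α ^ (p - 1) * ((-(p - 1) * (max (S (α * t)) 0) ^ (p - 1)) * (α * 1)))) t :=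
          (((hS.hasDerivAt_rpow (α * t) (hlt1.2 h)).comp t
            ((hasDerivAt_id t).const_mul α)).const_mul _).const_mul _
        refine (h1.congr_of_eventuallyEq ?_).congr_deriv ?_
        · filter_upwards [Iio_mem_nhds h] with s hs
          rw [hVlt s (le_of_lt hs), flux_of_nonneg hp (mul_nonneg hαpos.le (hCnn _)),
            Real.mul_rpow hαpos.le (hCnn _)]
        · rw [profile_of_le hp ha hb hL hS h.le, hlam, ← key a α ha hαpos hαμ]
          ring
      · have h1 : HasDerivAt
            (fun s => -(b ^ p * (β ^ (p - 1) * (fun s => C s ^ (p - 1)) (β * (L - s)))))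
            (-(b ^ p * (β ^ (p - 1) *
              ((-(p - 1) * (max (S (β * (L - t))) 0) ^ (p - 1)) * (β * -1))))) t :=
          ((((hS.hasDerivAt_rpow (β * (L - t)) (hlt2.2 h)).comp t
            (((hasDerivAt_id t).const_sub L).const_mul β)).const_mul _).const_mul _).neg
        refine (h1.congr_of_eventuallyEq ?_).congr_deriv ?_
        · filter_upwards [Ioi_mem_nhds h] with s hs
          have : 0 ≤ β * C (β * (L - s)) := mul_nonneg hβpos.le (hCnn _)
          rw [hVgt s (le_of_lt hs), flux_of_nonpos hp (by linarith), neg_neg,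
            Real.mul_rpow hβpos.le (hCnn _)]
        · rw [profile_of_ge hp ha hb hL hS (le_of_lt h), hlam, ← key b β hb hβpos hβμ]
          ring
    · exact ((continuous_flux hp).comp hVc).continuousAt
    · refine (continuous_const.mul ?_).continuousAt
      exact Continuous.rpow_const (hφc.max continuous_const) fun _ => Or.inr (by linarith)

/-- Exchanging `a` and `b` replaces `t₀` by `1 - t₀`, so every fact about the negative function
follows from the positive one. -/
lemma phiMinus_eq (hab : a + b ≠ 0) (φ : ℝ → ℝ) (t : ℝ) : phiMinus a b φ t = -phiPlus b a φ t := by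
  have h : 1 - gluePoint a b = gluePoint b a := by
    unfold gluePoint
    rw [add_comm b a]
    field_simp
    ring
  have h' : gluePoint a b = 1 - gluePoint b a := by linarith
  unfold phiMinus phiPlus
  rw [h]
  split_ifs
  · rfl
  · rw [h']
    congr 3
    ring

/-- The symmetric profile is `S (π_p t)` on the left half and its mirror image on the right.
Stretching the halves to lengths `t₀` and `1 - t₀` reproduces the frequencies of the asymmetric
profile. -/
lemma phiPlus_eq_profile (hp : 1 < p) (ha : 0 < a) (hb : 0 < b) (hL : 0 < L)
    (hS : IsSinP p S C) {φ : ℝ → ℝ} {c : ℝ}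
    (hφ : ∀ t ∈ Icc (0 : ℝ) 1, φ t = c * profile p 1 1 1 S t) {t : ℝ} (ht : t ∈ Icc 0 L) :
    phiPlus a b φ (t / L) = c * profile p a b L S t := by
  have hT : L * a / (a + b) = L * gluePoint a b := by unfold gluePoint; ring
  have hg : 0 < gluePoint a b := by unfold gluePoint; positivity
  have hg' : 1 - gluePoint a b = b / (a + b) := by
    unfold gluePoint
    field_simp
    ring
  have hg1 : 0 < 1 - gluePoint a b := by rw [hg']; positivity
  have hiff : t / L < gluePoint a b ↔ t < L * gluePoint a b := by
    rw [div_lt_iff₀ hL, mul_comm]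
  unfold phiPlus
  split_ifs with h
  · have hx : t / L / (2 * gluePoint a b) < 1 / 2 := by
      rw [div_lt_iff₀ (by positivity)]
      linarith
    have hx0 : 0 ≤ t / L / (2 * gluePoint a b) := div_nonneg (div_nonneg ht.1 hL.le) (by positivity)
    rw [hφ _ ⟨hx0, by linarith⟩,
      profile_of_le hp ha hb hL hS (hT ▸ (hiff.1 h).le),
      profile_of_le hp one_pos one_pos one_pos hS (by norm_num; linarith)]
    congr 2
    unfold gluePoint
    field_simp
    ring
  · have h' := not_lt.1 h
    have hxe : (t / L + 1 - 2 * gluePoint a b) / (2 * (1 - gluePoint a b)) =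
        1 - (1 - t / L) / (2 * (1 - gluePoint a b)) := by
      field_simp
      ring
    have hx : (1 - t / L) / (2 * (1 - gluePoint a b)) ≤ 1 / 2 := by
      rw [div_le_iff₀ (by positivity)]
      linarith
    have hx0 : 0 ≤ (1 - t / L) / (2 * (1 - gluePoint a b)) := by
      refine div_nonneg ?_ (by positivity)
      rw [sub_nonneg, div_le_one hL]
      exact ht.2
    rw [hxe, hφ _ ⟨by linarith, by linarith⟩,
      profile_of_ge hp ha hb hL hS (hT ▸ not_lt.1 fun h2 => h (hiff.2 h2)),
      profile_of_ge hp one_pos one_pos one_pos hS (by norm_num; linarith), hg']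
    congr 2
    field_simp
    ring

end

/-! ### Absolute continuity, primitives and the space W₀ -/

lemma setIntegral_Ioo_eq {L : ℝ} (hL : 0 ≤ L) (f : ℝ → ℝ) :
    ∫ t in Ioo 0 L, f t = ∫ t in (0 : ℝ)..L, f t := by
  rw [intervalIntegral.integral_of_le hL, integral_Ioc_eq_integral_Ioo]

lemma ae_uIoc_mem_Ioo {c d : ℝ} (hcd : c ≤ d) : ∀ᵐ x : ℝ, x ∈ uIoc c d → x ∈ Ioo c d := by
  have hne : ∀ᵐ x : ℝ, x ≠ d := by simp [ae_iff, measure_singleton]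
  filter_upwards [hne] with x hx hxm
  rw [uIoc_of_le hcd] at hxm
  exact ⟨hxm.1, lt_of_le_of_ne hxm.2 hx⟩

lemma ac_integral_eq_sub {f f' : ℝ → ℝ} {c d : ℝ} (hcd : c ≤ d)
    (hf : AbsolutelyContinuousOnInterval f c d)
    (h : ∀ᵐ x, x ∈ Ioo c d → HasDerivAt f (f' x) x) :
    IntervalIntegrable f' volume c d ∧ ∫ x in c..d, f' x = f d - f c := by
  have hae : ∀ᵐ x, x ∈ uIoc c d → deriv f x = f' x := by
    filter_upwards [h, ae_uIoc_mem_Ioo hcd] with x hx hx' hxm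
    exact (hx (hx' hxm)).deriv
  refine ⟨hf.intervalIntegrable_deriv.congr_ae ((ae_restrict_iff' measurableSet_uIoc).2 hae), ?_⟩
  rw [← hf.integral_deriv_eq_sub]
  exact (intervalIntegral.integral_congr_ae hae).symm

/-- The range of `f` is bounded, and a `C¹` function is Lipschitz on a bounded interval. -/
lemma ac_comp {f g : ℝ → ℝ} {c d : ℝ} (hg : ContDiff ℝ 1 g)
    (hf : AbsolutelyContinuousOnInterval f c d) :
    AbsolutelyContinuousOnInterval (fun t => g (f t)) c d := by
  obtain ⟨M, hM⟩ := hf.exists_bound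
  obtain ⟨K, hK⟩ := (hg.contDiffOn (s := Icc (-M) M)).exists_lipschitzOnWith (by decide)
    (convex_Icc _ _) isCompact_Icc
  have hmem : ∀ x ∈ uIcc c d, f x ∈ Icc (-M) M := fun x hx => abs_le.1 (hM x hx)
  rw [absolutelyContinuousOnInterval_iff] at hf ⊢
  intro ε hε
  obtain ⟨δ, hδ, H⟩ := hf (ε / (K + 1)) (by positivity)
  refine ⟨δ, hδ, fun E hE hEδ => ?_⟩
  have h1 := H E hE hEδ
  calc _ ≤ ∑ i ∈ Finset.range E.1, (K : ℝ) * dist (f (E.2 i).1) (f (E.2 i).2) := by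
        refine Finset.sum_le_sum fun i hi => ?_
        have := hE.1 i hi
        exact hK.dist_le_mul _ (hmem _ this.1) _ (hmem _ this.2)
    _ = K * ∑ i ∈ Finset.range E.1, dist (f (E.2 i).1) (f (E.2 i).2) := by rw [Finset.mul_sum]
    _ ≤ K * (ε / (K + 1)) := by gcongr
    _ < ε := by
        rw [mul_div_assoc', div_lt_iff₀ (by positivity)]
        nlinarith [K.coe_nonneg]

/-- On `[0, L]`, `u` is the primitive of `v` vanishing at `0`. -/
structure IsPrimitive (L : ℝ) (u v : ℝ → ℝ) : Prop where
  integrable : IntervalIntegrable v volume 0 L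
  eq : ∀ t ∈ Icc 0 L, u t = ∫ s in (0 : ℝ)..t, v s

section

variable {p L : ℝ} {u v : ℝ → ℝ}

lemma IsPrimitive.neg (h : IsPrimitive L u v) :
    IsPrimitive L (fun t => -u t) (fun t => -v t) :=
  ⟨h.integrable.neg, fun t ht => by simp [h.eq t ht]⟩

lemma ac_congr {f g : ℝ → ℝ} {c d : ℝ} (h : EqOn f g (uIcc c d))
    (hf : AbsolutelyContinuousOnInterval f c d) : AbsolutelyContinuousOnInterval g c d := by
  rw [absolutelyContinuousOnInterval_iff] at hf ⊢
  intro ε hε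
  obtain ⟨δ, hδ, H⟩ := hf ε hε
  refine ⟨δ, hδ, fun E hE hEδ => ?_⟩
  refine lt_of_eq_of_lt (Finset.sum_congr rfl fun i hi => ?_) (H E hE hEδ)
  have := hE.1 i hi
  rw [h this.1, h this.2]

lemma IsPrimitive.ac (hL : 0 ≤ L) (h : IsPrimitive L u v) :
    AbsolutelyContinuousOnInterval u 0 L := by
  refine ac_congr (fun t ht => ?_)
    (h.integrable.absolutelyContinuousOnInterval_intervalIntegral left_mem_uIcc)
  rw [uIcc_of_le hL] at ht
  exact (h.eq t ht).symm

lemma IsPrimitive.continuousOn (hL : 0 ≤ L) (h : IsPrimitive L u v) :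
    ContinuousOn u (Icc 0 L) := by
  have := (h.ac hL).continuousOn
  rwa [uIcc_of_le hL] at this

lemma IsPrimitive.ae_hasDerivAt (hL : 0 ≤ L) (h : IsPrimitive L u v) :
    ∀ᵐ t, t ∈ Ioo 0 L → HasDerivAt u (v t) t := by
  filter_upwards [h.integrable.ae_hasDerivAt_integral] with t ht htm
  refine (ht ?_ 0 left_mem_uIcc).congr_of_eventuallyEq ?_
  · rw [uIcc_of_le hL]
    exact Ioo_subset_Icc_self htm
  · filter_upwards [Ioo_mem_nhds htm.1 htm.2] with s hs
    exact h.eq s (Ioo_subset_Icc_self hs)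

/-- The boundary condition is left as a product so that it covers both a test function `f` and a
flux `f` paired with `u L = 0`. -/
lemma IsPrimitive.integral_mul_deriv (hL : 0 ≤ L) (h : IsPrimitive L u v)
    {f f' : ℝ → ℝ} (hu : u L * f L = 0) (hf : ∀ t, HasDerivAt f (f' t) t) (hf' : Continuous f') :
    ∫ t in Ioo 0 L, u t * f' t = -∫ t in Ioo 0 L, v t * f t := by
  have hd : deriv f = f' := funext fun t => (hf t).deriv
  have hfac : AbsolutelyContinuousOnInterval f 0 L := by
    refine ContDiffOn.absolutelyContinuousOnInterval (ContDiff.contDiffOn ?_)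
    rw [contDiff_one_iff_deriv, hd]
    exact ⟨fun t => (hf t).differentiableAt, hf'⟩
  have h0 : u 0 = 0 := by simp [h.eq 0 (left_mem_Icc.2 hL)]
  have hae : ∀ᵐ x, x ∈ uIoc 0 L → deriv u x * f x = v x * f x := by
    filter_upwards [h.ae_hasDerivAt hL, ae_uIoc_mem_Ioo hL] with x hx hx' hxm
    rw [(hx (hx' hxm)).deriv]
  rw [setIntegral_Ioo_eq hL, setIntegral_Ioo_eq hL, ← hd,
    (h.ac hL).integral_mul_deriv_eq_deriv_mul hfac, hu, h0,
    intervalIntegral.integral_congr_ae hae]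
  ring

lemma IsTestFunction.eq_zero_of_notMem {η : ℝ → ℝ} (h : IsTestFunction L η) {t : ℝ}
    (ht : t ∉ Ioo 0 L) : η t = 0 :=
  image_eq_zero_of_notMem_tsupport fun h' => ht (h.2.2 h')

theorem IsPrimitive.memW₀ (hL : 0 ≤ L) (h : IsPrimitive L u v) (hu : u L = 0)
    (hv : MemLp v (ENNReal.ofReal p) (volume.restrict (Ioo 0 L))) : MemW₀ p L u v where
  continuousOn := h.continuousOn hL
  left := by simp [h.eq 0 (left_mem_Icc.2 hL)]
  right := hu
  memLp_deriv := hv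
  weak_deriv η hη := by
    have hd := hη.1.differentiable (by simp)
    exact h.integral_mul_deriv hL (by simp [hu]) (fun t => (hd t).hasDerivAt)
      (hη.1.continuous_deriv (by simp))

/-- The primitive from `0` vanishes to the left of the support trivially, and to the right because
it equals the total integral, which is zero. -/
lemma IsTestFunction.exists_primitive {θ : ℝ → ℝ} (h : IsTestFunction L θ)
    (hint : ∫ t in Ioo 0 L, θ t = 0) : ∃ η, IsTestFunction L η ∧ deriv η = θ := by
  rcases (tsupport θ).eq_empty_or_nonempty with he | hne
  · have : θ = 0 := tsupport_eq_empty_iff.1 he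
    refine ⟨0, ?_, ?_⟩
    · rw [← this]; exact h
    · rw [this]; simp
  obtain ⟨c, hc, hc'⟩ := h.2.1.isCompact.exists_isLeast hne
  obtain ⟨d, hd, hd'⟩ := h.2.1.isCompact.exists_isGreatest hne
  have hcI := h.2.2 hc
  have hdI := h.2.2 hd
  have hL : 0 ≤ L := by linarith [hcI.1, hcI.2]
  rw [setIntegral_Ioo_eq hL] at hint
  have hθc := h.1.continuous
  have hii : ∀ x y, IntervalIntegrable θ volume x y := fun x y => hθc.intervalIntegrable x y
  have hzero : ∀ t, t ∉ Icc c d → θ t = 0 := fun t ht =>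
    image_eq_zero_of_notMem_tsupport fun h' => ht ⟨hc' h', hd' h'⟩
  set η : ℝ → ℝ := fun t => ∫ s in (0 : ℝ)..t, θ s with hη
  have hder : ∀ t, HasDerivAt η (θ t) t := fun t =>
    intervalIntegral.integral_hasDerivAt_right (hii _ _) (hθc.stronglyMeasurableAtFilter _ _)
      hθc.continuousAt
  have hdη : deriv η = θ := funext fun t => (hder t).deriv
  have hsupp : tsupport η ⊆ Icc c d := by
    refine closure_minimal (fun t ht => ?_) isClosed_Icc
    by_contra hcon
    refine ht ?_
    rcases lt_or_ge t c with h1 | h1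
    · refine intervalIntegral.integral_zero_ae (Filter.Eventually.of_forall fun s hs => ?_)
      refine hzero s fun hs' => ?_
      rcases le_total 0 t with h0 | h0
      · rw [uIoc_of_le h0] at hs
        linarith [hs.2, hs'.1]
      · rw [uIoc_of_ge h0] at hs
        linarith [hs.2, hs'.1, hcI.1]
    · have h2 : d < t := by
        by_contra h3
        exact hcon ⟨h1, not_lt.1 h3⟩
      have : η t = (∫ s in (0 : ℝ)..L, θ s) + ∫ s in L..t, θ s :=
        (intervalIntegral.integral_add_adjacent_intervals (hii _ _) (hii _ _)).symm
      rw [this, hint, zero_add]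
      refine intervalIntegral.integral_zero_ae (Filter.Eventually.of_forall fun s hs => ?_)
      refine hzero s fun hs' => ?_
      rcases le_total L t with h0 | h0
      · rw [uIoc_of_le h0] at hs
        linarith [hs.1, hs'.2, hdI.2]
      · rw [uIoc_of_ge h0] at hs
        linarith [hs.1, hs'.2]
  refine ⟨η, ⟨?_, ?_, ?_⟩, hdη⟩
  · rw [contDiff_infty_iff_deriv, hdη]
    exact ⟨fun t => (hder t).differentiableAt, h.1⟩
  · exact HasCompactSupport.of_support_subset_isCompact isCompact_Icc
      ((subset_tsupport η).trans hsupp)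
  · exact hsupp.trans fun t ht => ⟨hcI.1.trans_le ht.1, ht.2.trans_lt hdI.2⟩

lemma exists_isTestFunction_integral_eq_one (hL : 0 < L) :
    ∃ ρ, IsTestFunction L ρ ∧ ∫ t in Ioo 0 L, ρ t = 1 := by
  let f : ContDiffBump (L / 2) := ⟨L / 8, L / 4, by positivity, by linarith⟩
  have hs : tsupport (f.normed volume) ⊆ Ioo 0 L := by
    rw [f.tsupport_normed_eq, Real.closedBall_eq_Icc]
    change Icc (L / 2 - L / 4) (L / 2 + L / 4) ⊆ Ioo 0 L
    intro t ht
    exact ⟨by linarith [ht.1], by linarith [ht.2]⟩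
  refine ⟨f.normed volume, ⟨f.contDiff_normed, f.hasCompactSupport_normed, hs⟩, ?_⟩
  rw [setIntegral_eq_integral_of_forall_compl_eq_zero, f.integral_normed]
  exact fun t ht => image_eq_zero_of_notMem_tsupport fun h' => ht (hs h')

/-- The lemma of du Bois-Reymond. -/
theorem exists_eqOn_const_of_integral_mul_deriv_eq_zero (hL : 0 < L) {h : ℝ → ℝ}
    (hc : ContinuousOn h (Icc 0 L))
    (H : ∀ η, IsTestFunction L η → ∫ t in Ioo 0 L, h t * deriv η t = 0) :
    ∃ k, ∀ t ∈ Icc 0 L, h t = k := by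
  obtain ⟨ρ, hρ, hρ1⟩ := exists_isTestFunction_integral_eq_one hL
  have hint : ∀ {g : ℝ → ℝ}, Continuous g → IntegrableOn (fun t => h t * g t) (Ioo 0 L) :=
    fun hg => (hc.mul hg.continuousOn).integrableOn_Icc.mono_set Ioo_subset_Icc_self
  have hint' : ∀ {g : ℝ → ℝ}, Continuous g → IntegrableOn g (Ioo 0 L) :=
    fun hg => hg.integrableOn_Icc.mono_set Ioo_subset_Icc_self
  set k := ∫ t in Ioo 0 L, h t * ρ t with hk
  have hae : ∀ᵐ x, x ∈ Ioo 0 L → h x - k = 0 := by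
    refine isOpen_Ioo.ae_eq_zero_of_integral_contDiff_smul_eq_zero ?_ ?_
    · refine ContinuousOn.locallyIntegrableOn ?_ measurableSet_Ioo
      exact (hc.mono Ioo_subset_Icc_self).sub continuousOn_const
    · intro ζ h1 h2 h3
      set m := ∫ t in Ioo 0 L, ζ t with hm
      -- Subtracting `m * ρ` makes the mean zero, so the result is the derivative of an admissible
      -- test function.
      have hθ : IsTestFunction L (fun t => ζ t - m * ρ t) := by
        refine ⟨h1.sub (contDiff_const.mul hρ.1), h2.sub hρ.2.1.mul_left, ?_⟩
        refine (tsupport_sub _ _).trans (union_subset h3 ?_)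
        exact (tsupport_mul_subset_right (f := fun _ => m)).trans hρ.2.2
      have hθ0 : ∫ t in Ioo 0 L, (ζ t - m * ρ t) = 0 := by
        rw [integral_sub (hint' h1.continuous) ((hint' hρ.1.continuous).const_mul m),
          integral_const_mul, hρ1]
        ring
      obtain ⟨η, hη, hηd⟩ := hθ.exists_primitive hθ0
      have h4 := H η hη
      rw [hηd] at h4
      have h5 : ∫ t in Ioo 0 L, h t * (ζ t - m * ρ t) =
          (∫ t in Ioo 0 L, h t * ζ t) - m * k := by
        rw [hk, ← integral_const_mul, ← integral_sub (hint h1.continuous)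
          ((hint hρ.1.continuous).const_mul m)]
        congr 1
        funext t
        ring
      have h6 : ∫ x, ζ x • (h x - k) = ∫ t in Ioo 0 L, ζ t • (h t - k) := by
        rw [setIntegral_eq_integral_of_forall_compl_eq_zero]
        intro t ht
        rw [image_eq_zero_of_notMem_tsupport fun h' => ht (h3 h'), zero_smul]
      have h7 : ∫ t in Ioo 0 L, ζ t • (h t - k) = (∫ t in Ioo 0 L, h t * ζ t) - k * m := by
        rw [hm, ← integral_const_mul, ← integral_sub (hint h1.continuous)
          ((hint' h1.continuous).const_mul k)]
        congr 1
        funext t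
        rw [smul_eq_mul]
        ring
      rw [h6, h7, mul_comm, ← h5, h4]
  refine ⟨k, Measure.eqOn_Icc_of_ae_eq (μ := volume) hL.ne ?_ hc continuousOn_const⟩
  rw [← restrict_Ioo_eq_restrict_Icc, Filter.EventuallyEq, ae_restrict_iff' measurableSet_Ioo]
  filter_upwards [hae] with x hx hxm
  linarith [hx hxm]

lemma MemW₀.intervalIntegrable (hp : 1 < p) (hL : 0 ≤ L) (h : MemW₀ p L u v) :
    IntervalIntegrable v volume 0 L := by
  rw [intervalIntegrable_iff_integrableOn_Ioo_of_le hL]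
  exact h.memLp_deriv.integrable (by rw [ENNReal.one_le_ofReal]; exact hp.le)

/-- The difference of `u` and the primitive of `v` has weak derivative zero, hence is constant, and
it vanishes at `0`. -/
theorem MemW₀.isPrimitive (hp : 1 < p) (hL : 0 < L) (h : MemW₀ p L u v) : IsPrimitive L u v := by
  have hv := h.intervalIntegrable hp hL.le
  set U : ℝ → ℝ := fun t => ∫ s in (0 : ℝ)..t, v s with hU
  have hUp : IsPrimitive L U v := ⟨hv, fun t _ => rfl⟩
  have hUc := hUp.continuousOn hL.le
  obtain ⟨k, hk⟩ := exists_eqOn_const_of_integral_mul_deriv_eq_zero hL (h.continuousOn.sub hUc) (by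
    intro η hη
    have hd := hη.1.differentiable (by simp)
    have hdc : Continuous (deriv η) := hη.1.continuous_deriv (by simp)
    have h1 := h.weak_deriv η hη
    have h2 : ∫ t in Ioo 0 L, U t * deriv η t = -∫ t in Ioo 0 L, v t * η t :=
      hUp.integral_mul_deriv hL.le (by rw [hη.eq_zero_of_notMem (by simp), mul_zero])
        (fun t => (hd t).hasDerivAt) hdc
    have hint : ∀ {f : ℝ → ℝ}, ContinuousOn f (Icc 0 L) →
        IntegrableOn (fun t => f t * deriv η t) (Ioo 0 L) := fun hf =>
      (hf.mul hdc.continuousOn).integrableOn_Icc.mono_set Ioo_subset_Icc_self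
    calc ∫ t in Ioo 0 L, (u - U) t * deriv η t
        = (∫ t in Ioo 0 L, u t * deriv η t) - ∫ t in Ioo 0 L, U t * deriv η t := by
          rw [← integral_sub (hint h.continuousOn) (hint hUc)]
          congr 1
          funext t
          simp only [Pi.sub_apply]
          ring
      _ = 0 := by rw [h1, h2, sub_self])
  refine ⟨hv, fun t ht => ?_⟩
  have h0 := hk 0 (left_mem_Icc.2 hL.le)
  have ht := hk t ht
  simp only [Pi.sub_apply, h.left, hU, intervalIntegral.integral_same, sub_self] at h0 ht
  linarith

end

/-! ### Energy density, flux and the pointwise Picone inequality -/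

open Filter Topology

/-- The energy density of `-Δ_p^{a,b}`. -/
noncomputable def energy (p a b s : ℝ) : ℝ := a ^ p * (max s 0) ^ p + b ^ p * (max (-s) 0) ^ p

section Pointwise

variable {p a b : ℝ}

/-- Strict convexity of `s ^ p`: the tangent at `y` stays below the graph. For `y > 0` it is
Bernoulli's inequality at `s / y - 1`, scaled by `y ^ p`. -/
lemma tangent_lt_rpow (hp : 1 < p) {y s : ℝ} (hy : 0 ≤ y) (hs : 0 ≤ s) (hne : s ≠ y) :
    (1 - p) * y ^ p + p * y ^ (p - 1) * s < s ^ p := by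
  rcases hy.eq_or_lt with rfl | hy
  · rw [Real.zero_rpow (by linarith), Real.zero_rpow (by linarith)]
    have := Real.rpow_pos_of_pos (lt_of_le_of_ne hs hne.symm) p
    linarith
  · have h := one_add_mul_self_lt_rpow_one_add (s := s / y - 1)
      (by linarith [div_nonneg hs hy.le]) (fun h => hne (by
        rw [sub_eq_zero, div_eq_one_iff_eq hy.ne'] at h
        exact h)) hp
    rw [add_sub_cancel, Real.div_rpow hs hy.le, lt_div_iff₀ (Real.rpow_pos_of_pos hy p)] at h
    have h2 : y ^ p = y ^ (p - 1) * y := by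
      rw [← Real.rpow_add_one hy.ne', sub_add_cancel]
    refine lt_of_eq_of_lt ?_ h
    rw [h2]
    field_simp
    ring

lemma tangent_le_rpow (hp : 1 < p) {y s : ℝ} (hy : 0 ≤ y) (hs : 0 ≤ s) :
    (1 - p) * y ^ p + p * y ^ (p - 1) * s ≤ s ^ p := by
  by_cases h : s = y
  · subst h
    rcases hs.eq_or_lt with rfl | hs
    · rw [Real.zero_rpow (by linarith), Real.zero_rpow (by linarith)]
      simp
    · have h2 : s ^ p = s ^ (p - 1) * s := by
        rw [← Real.rpow_add_one hs.ne', sub_add_cancel]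
      rw [h2]
      apply le_of_eq
      ring
  · exact (tangent_lt_rpow hp hy hs h).le

lemma energy_of_nonneg (hp : 1 < p) {s : ℝ} (hs : 0 ≤ s) : energy p a b s = a ^ p * s ^ p := by
  unfold energy
  rw [max_eq_left hs, max_eq_right (by linarith : -s ≤ 0), Real.zero_rpow (by linarith : p ≠ 0)]
  ring

lemma energy_neg (s : ℝ) : energy p a b (-s) = energy p b a s := by
  unfold energy
  rw [neg_neg, add_comm]

lemma flux_neg (s : ℝ) : flux p a b (-s) = -flux p b a s := by
  unfold flux
  rw [neg_neg]
  ring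

lemma energy_nonneg (ha : 0 < a) (hb : 0 < b) (s : ℝ) : 0 ≤ energy p a b s := by
  unfold energy
  have := Real.rpow_nonneg (le_max_right s 0) p
  have := Real.rpow_nonneg (le_max_right (-s) 0) p
  positivity

lemma continuous_energy (hp : 1 < p) : Continuous (energy p a b) := by
  unfold energy
  have h : 0 ≤ p := by linarith
  refine (continuous_const.mul ?_).add (continuous_const.mul ?_)
  · exact Continuous.rpow_const (by fun_prop) fun _ => Or.inr h
  · exact Continuous.rpow_const (by fun_prop) fun _ => Or.inr h

lemma flux_mul_self (hp : 1 < p) (s : ℝ) : flux p a b s * s = energy p a b s := by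
  have key : ∀ {a b s : ℝ}, 0 ≤ s → flux p a b s * s = energy p a b s := by
    intro a b s hs
    rw [flux_of_nonneg hp hs, energy_of_nonneg hp hs]
    rcases hs.eq_or_lt with rfl | hs
    · rw [Real.zero_rpow (by linarith : p ≠ 0)]
      ring
    · rw [mul_assoc, ← Real.rpow_add_one hs.ne', sub_add_cancel]
  rcases le_total 0 s with hs | hs
  · exact key hs
  · have := key (a := b) (b := a) (s := -s) (by linarith)
    rw [flux_neg, energy_neg] at this
    linarith

lemma flux_mul {c : ℝ} (hc : 0 ≤ c) (s : ℝ) :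
    flux p a b (c * s) = c ^ (p - 1) * flux p a b s := by
  unfold flux
  have h : ∀ x : ℝ, max (c * x) 0 = c * max x 0 := fun x => by
    rw [mul_max_of_nonneg _ _ hc, mul_zero]
  rw [← mul_neg, h, h, Real.mul_rpow hc (le_max_right _ _), Real.mul_rpow hc (le_max_right _ _)]
  ring

lemma energy_le (hp : 1 < p) (ha : 0 < a) (hb : 0 < b) (s : ℝ) :
    energy p a b s ≤ (a ^ p + b ^ p) * |s| ^ p := by
  have hp0 : 0 ≤ p := by linarith
  have h1 : (max s 0) ^ p ≤ |s| ^ p :=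
    Real.rpow_le_rpow (le_max_right _ _) (max_le (le_abs_self s) (abs_nonneg s)) hp0
  have h2 : (max (-s) 0) ^ p ≤ |s| ^ p :=
    Real.rpow_le_rpow (le_max_right _ _) (max_le (neg_le_abs s) (abs_nonneg s)) hp0
  have := Real.rpow_pos_of_pos ha p
  have := Real.rpow_pos_of_pos hb p
  unfold energy
  nlinarith

/-- The Picone inequality for the energy density, with its equality case. -/
lemma picone_energy (hp : 1 < p) (ha : 0 < a) (hb : 0 < b) {x : ℝ} (hx : 0 < x) (m s : ℝ) :
    (1 - p) * x ^ p * energy p a b m + p * x ^ (p - 1) * flux p a b m * s ≤ energy p a b s ∧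
      ((1 - p) * x ^ p * energy p a b m + p * x ^ (p - 1) * flux p a b m * s = energy p a b s →
        s = m * x) := by
  have key : ∀ {a b m s : ℝ}, 0 < a → 0 < b → 0 ≤ m →
      (1 - p) * x ^ p * energy p a b m + p * x ^ (p - 1) * flux p a b m * s ≤ energy p a b s ∧
      ((1 - p) * x ^ p * energy p a b m + p * x ^ (p - 1) * flux p a b m * s = energy p a b s →
        s = m * x) := by
    intro a b m s ha hb hm
    have hA := Real.rpow_pos_of_pos ha p
    have hB := Real.rpow_pos_of_pos hb p
    have hy : 0 ≤ m * x := mul_nonneg hm hx.le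
    -- For `m ≥ 0` the left side is `a ^ p` times the tangent to `s ^ p` at the point `m * x`.
    have hl : (1 - p) * x ^ p * energy p a b m + p * x ^ (p - 1) * flux p a b m * s =
        a ^ p * ((1 - p) * (m * x) ^ p + p * (m * x) ^ (p - 1) * s) := by
      rw [energy_of_nonneg hp hm, flux_of_nonneg hp hm, Real.mul_rpow hm hx.le,
        Real.mul_rpow hm hx.le]
      ring
    rw [hl]
    rcases le_or_gt 0 s with hs | hs
    · rw [energy_of_nonneg hp hs]
      refine ⟨mul_le_mul_of_nonneg_left (tangent_le_rpow hp hy hs) hA.le, fun h => ?_⟩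
      by_contra hne
      exact (tangent_lt_rpow hp hy hs hne).ne (mul_left_cancel₀ hA.ne' h)
    -- For `s < 0` the tangent value is nonpositive while the energy is positive, so equality cannot
    -- occur.
    · have h1 : 0 < energy p a b s := by
        rw [← neg_neg s, energy_neg, energy_of_nonneg hp (by linarith)]
        exact mul_pos hB (Real.rpow_pos_of_pos (by linarith) p)
      have h2 : (1 - p) * (m * x) ^ p + p * (m * x) ^ (p - 1) * s ≤ 0 := by
        have e1 := Real.rpow_nonneg hy p
        have e2 := Real.rpow_nonneg hy (p - 1)
        have e3 : (1 - p) * (m * x) ^ p ≤ 0 := mul_nonpos_of_nonpos_of_nonneg (by linarith) e1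
        have e4 : p * (m * x) ^ (p - 1) * s ≤ 0 :=
          mul_nonpos_of_nonneg_of_nonpos (by positivity) hs.le
        linarith
      have h3 := mul_nonpos_of_nonneg_of_nonpos hA.le h2
      exact ⟨by linarith, fun h => absurd h (by linarith)⟩
  rcases le_total 0 m with hm | hm
  · exact key ha hb hm
  · have h := key (m := -m) (s := -s) hb ha (by linarith)
    rw [energy_neg, energy_neg, flux_neg] at h
    refine ⟨by linarith [h.1], fun h' => ?_⟩
    have := h.2 (by linarith)
    linarith

end Pointwise

/-! ### Decay estimates at the endpoints -/

section Boundary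

variable {p L : ℝ}

/-- Hölder's inequality, obtained by integrating the tangent inequality for `s ^ p` at the mean `A`
of `|v|`. -/
lemma abs_integral_rpow_le (hp : 1 < p) {v : ℝ → ℝ} {x y : ℝ} (hxy : x < y)
    (hv : IntervalIntegrable v volume x y)
    (hvp : IntervalIntegrable (fun t => |v t| ^ p) volume x y) :
    |∫ t in x..y, v t| ^ p ≤ (y - x) ^ (p - 1) * ∫ t in x..y, |v t| ^ p := by
  have hl : 0 < y - x := by linarith
  set A := (∫ t in x..y, |v t|) / (y - x) with hA
  have hI : 0 ≤ ∫ t in x..y, |v t| :=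
    intervalIntegral.integral_nonneg hxy.le fun _ _ => abs_nonneg _
  have hA0 : 0 ≤ A := by positivity
  have hIA : ∫ t in x..y, |v t| = A * (y - x) := by rw [hA]; field_simp
  have h1 : ∫ t in x..y, ((1 - p) * A ^ p + p * A ^ (p - 1) * |v t|) ≤
      ∫ t in x..y, |v t| ^ p :=
    intervalIntegral.integral_mono_on hxy.le
      (intervalIntegrable_const.add (hv.abs.const_mul _)) hvp
      fun t _ => tangent_le_rpow hp hA0 (abs_nonneg _)
  rw [intervalIntegral.integral_add intervalIntegrable_const (hv.abs.const_mul _),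
    intervalIntegral.integral_const, intervalIntegral.integral_const_mul, hIA, smul_eq_mul] at h1
  have h2 : A ^ (p - 1) * A = A ^ p := by
    rcases hA0.eq_or_lt with h | h
    · rw [← h, Real.zero_rpow (by linarith : p ≠ 0), mul_zero]
    · rw [← Real.rpow_add_one h.ne', sub_add_cancel]
  have h3 : A ^ p * (y - x) ≤ ∫ t in x..y, |v t| ^ p := by
    refine le_trans (le_of_eq ?_) h1
    linear_combination -(p * (y - x)) * h2
  calc |∫ t in x..y, v t| ^ p ≤ (A * (y - x)) ^ p := by
        refine Real.rpow_le_rpow (abs_nonneg _) ?_ (by linarith)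
        rw [← hIA]
        exact intervalIntegral.abs_integral_le_integral_abs hxy.le
    _ = (y - x) ^ (p - 1) * (A ^ p * (y - x)) := by
        rw [Real.mul_rpow hA0 hl.le]
        have : (y - x) ^ p = (y - x) ^ (p - 1) * (y - x) := by
          rw [← Real.rpow_add_one hl.ne', sub_add_cancel]
        rw [this]
        ring
    _ ≤ _ := by gcongr

/-- Near `0` the function `φ` is comparable to `m * ε`, so `φ ^ (1 - p)` exactly cancels the factor
`ε ^ (p - 1)` and leaves `g → 0`. -/
lemma tendsto_boundary_term (hp : 1 < p) {u φ F g : ℝ → ℝ} {m : ℝ} (hm : 0 < m)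
    (hφ : HasDerivAt φ m 0) (hφ0 : φ 0 = 0) (hg : Tendsto g (𝓝[>] 0) (𝓝 0))
    (hu : ∀ᶠ ε in 𝓝[>] 0, |u ε| ^ p ≤ ε ^ (p - 1) * g ε) (hF : ContinuousAt F 0) :
    Tendsto (fun ε => (max (u ε) 0) ^ p * φ ε ^ (1 - p) * F ε) (𝓝[>] 0) (𝓝 0) := by
  have hs : Tendsto (fun ε => φ ε / ε) (𝓝[>] 0) (𝓝 m) := by
    have := (hasDerivAt_iff_tendsto_slope.1 hφ).mono_left
      (nhdsWithin_mono 0 (fun x hx => ne_of_gt hx))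
    refine this.congr fun ε => ?_
    rw [slope_def_field, hφ0, sub_zero, sub_zero]
  have hs' : Tendsto (fun ε => (φ ε / ε) ^ (1 - p)) (𝓝[>] 0) (𝓝 (m ^ (1 - p))) :=
    hs.rpow_const (Or.inl hm.ne')
  have hlim : Tendsto (fun ε => g ε * (φ ε / ε) ^ (1 - p) * |F ε|) (𝓝[>] 0) (𝓝 0) := by
    have := (hg.mul hs').mul (hF.abs.tendsto.mono_left nhdsWithin_le_nhds)
    simpa using this
  refine squeeze_zero_norm' ?_ hlim
  filter_upwards [hu, hs.eventually_const_lt hm, self_mem_nhdsWithin] with ε h1 h2 h3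
  have hε : 0 < ε := h3
  have hφε : 0 < φ ε := by
    have := mul_pos h2 hε
    rwa [div_mul_cancel₀ _ hε.ne'] at this
  rw [norm_mul, norm_mul, Real.norm_eq_abs (F ε),
    Real.norm_of_nonneg (Real.rpow_nonneg (le_max_right _ _) _),
    Real.norm_of_nonneg (Real.rpow_nonneg hφε.le _)]
  refine mul_le_mul_of_nonneg_right ?_ (abs_nonneg _)
  have h4 : (max (u ε) 0) ^ p ≤ ε ^ (p - 1) * g ε := by
    refine le_trans ?_ h1
    exact Real.rpow_le_rpow (le_max_right _ _) (max_le (le_abs_self _) (abs_nonneg _))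
      (by linarith)
  have h5 : (φ ε / ε) ^ (1 - p) = φ ε ^ (1 - p) * ε ^ (p - 1) := by
    rw [Real.div_rpow hφε.le hε.le, div_eq_mul_inv, ← Real.rpow_neg hε.le, neg_sub]
  rw [h5]
  have := mul_le_mul_of_nonneg_right h4 (Real.rpow_nonneg hφε.le (1 - p))
  linarith

end Boundary

/-! ### The calibration argument -/

section Calibration

variable {p a b L lam : ℝ} {φ V u v : ℝ → ℝ}

lemma intervalIntegrable_abs_rpow (hp : 1 < p) (hL : 0 ≤ L)
    (hv : MemLp v (ENNReal.ofReal p) (volume.restrict (Ioo 0 L))) :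
    IntervalIntegrable (fun t => |v t| ^ p) volume 0 L := by
  rw [intervalIntegrable_iff_integrableOn_Ioo_of_le hL]
  have := hv.integrable_norm_rpow (by simp; linarith) ENNReal.ofReal_ne_top
  rw [ENNReal.toReal_ofReal (by linarith)] at this
  exact this

lemma integrableOn_energy (hp : 1 < p) (ha : 0 < a) (hb : 0 < b)
    (hv : MemLp v (ENNReal.ofReal p) (volume.restrict (Ioo 0 L))) :
    IntegrableOn (fun t => energy p a b (v t)) (Ioo 0 L) := by
  have h := hv.integrable_norm_rpow (by simp; linarith) ENNReal.ofReal_ne_top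
  rw [ENNReal.toReal_ofReal (by linarith)] at h
  refine (h.const_mul (a ^ p + b ^ p)).mono'
    ((continuous_energy hp).comp_aestronglyMeasurable hv.aestronglyMeasurable) ?_
  refine Eventually.of_forall fun t => ?_
  rw [Real.norm_of_nonneg (energy_nonneg ha hb _)]
  exact energy_le hp ha hb _

lemma tendsto_sub_nhdsGT (L : ℝ) (hL : 0 < L) :
    Tendsto (fun ε : ℝ => L - ε) (𝓝[>] 0) (𝓝[Icc 0 L] L) := by
  refine tendsto_nhdsWithin_iff.2 ⟨?_, ?_⟩
  · have : Tendsto (fun ε : ℝ => L - ε) (𝓝 0) (𝓝 (L - 0)) := by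
      exact (continuous_const.sub continuous_id).tendsto 0
    rw [sub_zero] at this
    exact this.mono_left nhdsWithin_le_nhds
  · filter_upwards [Ioo_mem_nhdsGT hL] with ε hε
    exact ⟨by linarith [hε.2], by linarith [hε.1]⟩

lemma tendsto_nhdsGT_Icc (hL : 0 < L) : Tendsto (fun ε : ℝ => ε) (𝓝[>] 0) (𝓝[Icc 0 L] 0) := by
  refine tendsto_nhdsWithin_iff.2 ⟨tendsto_id.mono_left nhdsWithin_le_nhds, ?_⟩
  filter_upwards [Ioo_mem_nhdsGT hL] with ε hε using Ioo_subset_Icc_self hε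

lemma continuousOn_primitive_Icc (hL : 0 ≤ L) {f : ℝ → ℝ} (hf : IntervalIntegrable f volume 0 L) :
    ContinuousOn (fun t => ∫ s in (0 : ℝ)..t, f s) (Icc 0 L) :=
  (IsPrimitive.mk (u := fun t => ∫ s in (0 : ℝ)..t, f s) hf fun _ _ => rfl).continuousOn hL

/-- The null Lagrangian `(u⁺)^p φ^(1-p) flux(φ')` calibrating the energy. -/
noncomputable def calibration (p a b : ℝ) (φ V u : ℝ → ℝ) (t : ℝ) : ℝ :=
  (max (u t) 0) ^ p * φ t ^ (1 - p) * flux p a b (V t)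

/-- Here `g` is the integral of `|v| ^ p` over `(0, ε)`, which tends to zero; this uses only that
`v` is in `L^p`. -/
lemma tendsto_calibration_left (hp : 1 < p) (hL : 0 < L) (hφ : IsProfile p a b L lam φ V)
    (hu : IsPrimitive L u v)
    (hv : MemLp v (ENNReal.ofReal p) (volume.restrict (Ioo 0 L))) :
    Tendsto (fun ε => calibration p a b φ V u ε) (𝓝[>] 0) (𝓝 0) := by
  have hvp := intervalIntegrable_abs_rpow hp hL.le hv
  have hF : Continuous fun t => flux p a b (V t) := (continuous_flux hp).comp hφ.continuous_deriv
  refine tendsto_boundary_term (g := fun ε => ∫ t in (0 : ℝ)..ε, |v t| ^ p) hp hφ.deriv_left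
    (hφ.hasDerivAt 0) hφ.left ?_ ?_ hF.continuousAt
  · have := (continuousOn_primitive_Icc hL.le hvp 0 (left_mem_Icc.2 hL.le)).tendsto.comp
      (tendsto_nhdsGT_Icc hL)
    simpa [Function.comp_def] using this
  · filter_upwards [Ioo_mem_nhdsGT hL] with ε hε
    have hsub : uIcc 0 ε ⊆ uIcc 0 L := by
      rw [uIcc_of_le hε.1.le, uIcc_of_le hL.le]
      exact Icc_subset_Icc_right hε.2.le
    have := abs_integral_rpow_le hp hε.1 (hu.integrable.mono_set hsub) (hvp.mono_set hsub)
    rwa [sub_zero, ← hu.eq ε (Ioo_subset_Icc_self hε)] at this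

lemma tendsto_calibration_right (hp : 1 < p) (hL : 0 < L) (hφ : IsProfile p a b L lam φ V)
    (hu : IsPrimitive L u v) (huL : u L = 0)
    (hv : MemLp v (ENNReal.ofReal p) (volume.restrict (Ioo 0 L))) :
    Tendsto (fun ε => calibration p a b φ V u (L - ε)) (𝓝[>] 0) (𝓝 0) := by
  have hvp := intervalIntegrable_abs_rpow hp hL.le hv
  have hF : Continuous fun ε => flux p a b (V (L - ε)) :=
    (continuous_flux hp).comp (hφ.continuous_deriv.comp (continuous_const.sub continuous_id))
  have hd : HasDerivAt (fun ε => φ (L - ε)) (-V L) 0 := by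
    have h1 : HasDerivAt φ (V L) (L - 0) := by
      rw [sub_zero]
      exact hφ.hasDerivAt L
    refine (HasDerivAt.comp (0 : ℝ) h1 ((hasDerivAt_id (0 : ℝ)).const_sub L)).congr_deriv ?_
    ring
  refine tendsto_boundary_term (u := fun ε => u (L - ε))
    (g := fun ε => (∫ t in (0 : ℝ)..L, |v t| ^ p) - ∫ t in (0 : ℝ)..(L - ε), |v t| ^ p) hp
    (neg_pos.2 hφ.deriv_right) hd (by rw [sub_zero, hφ.right]) ?_ ?_ hF.continuousAt
  · have := ((continuousOn_primitive_Icc hL.le hvp L (right_mem_Icc.2 hL.le)).tendsto.comp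
      (tendsto_sub_nhdsGT L hL)).const_sub (∫ t in (0 : ℝ)..L, |v t| ^ p)
    simpa using this
  · filter_upwards [Ioo_mem_nhdsGT hL] with ε hε
    have hlt : L - ε < L := by linarith [hε.1]
    have h0 : 0 ≤ L - ε := by linarith [hε.2]
    have hsub : uIcc (L - ε) L ⊆ uIcc 0 L := by
      rw [uIcc_of_le hlt.le, uIcc_of_le hL.le]
      exact Icc_subset_Icc_left h0
    have hsub' : uIcc 0 (L - ε) ⊆ uIcc 0 L := by
      rw [uIcc_of_le h0, uIcc_of_le hL.le]
      exact Icc_subset_Icc_right hlt.le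
    have := abs_integral_rpow_le hp hlt (hu.integrable.mono_set hsub) (hvp.mono_set hsub)
    have e : ∫ t in (L - ε)..L, v t = -u (L - ε) := by
      rw [← intervalIntegral.integral_interval_sub_left hu.integrable
        (hu.integrable.mono_set hsub'), ← hu.eq L (right_mem_Icc.2 hL.le), huL,
        hu.eq (L - ε) ⟨h0, hlt.le⟩]
      ring
    rw [e, abs_neg, sub_sub_cancel] at this
    rwa [intervalIntegral.integral_interval_sub_left hvp (hvp.mono_set hsub')]

lemma contDiff_max_rpow (hp : 1 < p) : ContDiff ℝ 1 (fun x : ℝ => (max x 0) ^ p) := by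
  rw [contDiff_one_iff_deriv]
  refine ⟨fun x => (hasDerivAt_max_rpow hp x).differentiableAt, ?_⟩
  rw [show deriv (fun x : ℝ => (max x 0) ^ p) = fun x => p * (max x 0) ^ (p - 1) from
    funext fun x => (hasDerivAt_max_rpow hp x).deriv]
  exact continuous_const.mul (Continuous.rpow_const (by fun_prop) fun _ => Or.inr (by linarith))

lemma IsProfile.continuous (hφ : IsProfile p a b L lam φ V) : Continuous φ :=
  continuous_iff_continuousAt.2 fun t => (hφ.hasDerivAt t).continuousAt

lemma IsProfile.contDiff (hφ : IsProfile p a b L lam φ V) : ContDiff ℝ 1 φ := by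
  rw [contDiff_one_iff_deriv, show deriv φ = V from funext fun t => (hφ.hasDerivAt t).deriv]
  exact ⟨fun t => (hφ.hasDerivAt t).differentiableAt, hφ.continuous_deriv⟩

lemma IsProfile.continuous_deriv_flux (hp : 1 < p) (hφ : IsProfile p a b L lam φ V) :
    Continuous fun t => -lam * (max (φ t) 0) ^ (p - 1) :=
  continuous_const.mul (Continuous.rpow_const (hφ.continuous.max continuous_const)
    fun _ => Or.inr (by linarith))

lemma IsProfile.contDiff_flux (hp : 1 < p) (hφ : IsProfile p a b L lam φ V) :
    ContDiff ℝ 1 (fun t => flux p a b (V t)) := by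
  rw [contDiff_one_iff_deriv, show deriv (fun t => flux p a b (V t)) = _ from
    funext fun t => (hφ.hasDerivAt_flux t).deriv]
  exact ⟨fun t => (hφ.hasDerivAt_flux t).differentiableAt, hφ.continuous_deriv_flux hp⟩

lemma IsProfile.ac_rpow (hφ : IsProfile p a b L lam φ V) (r : ℝ) {c d : ℝ} (hc : 0 < c)
    (hcd : c ≤ d) (hd : d < L) :
    AbsolutelyContinuousOnInterval (fun t => φ t ^ r) c d := by
  refine ContDiffOn.absolutelyContinuousOnInterval ?_
  refine hφ.contDiff.contDiffOn.rpow_const_of_ne fun t ht => ?_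
  rw [uIcc_of_le hcd] at ht
  exact (hφ.pos t ⟨hc.trans_le ht.1, ht.2.trans_lt hd⟩).ne'

lemma IsPrimitive.ac_max_rpow (hp : 1 < p) (hu : IsPrimitive L u v) {c d : ℝ} (hc : 0 < c)
    (hcd : c ≤ d) (hd : d < L) :
    AbsolutelyContinuousOnInterval (fun t => (max (u t) 0) ^ p) c d := by
  have hL : 0 ≤ L := by linarith
  have hsub : uIcc c d ⊆ uIcc 0 L := by
    rw [uIcc_of_le hcd, uIcc_of_le hL]
    exact Icc_subset_Icc hc.le hd.le
  exact ac_comp (g := fun x : ℝ => (max x 0) ^ p) (contDiff_max_rpow hp) ((hu.ac hL).mono hsub)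

lemma hasDerivAt_max_rpow_mul_rpow (hp : 1 < p) {t : ℝ} (r : ℝ) (hφ : HasDerivAt φ (V t) t)
    (hpos : 0 < φ t) (hu : HasDerivAt u (v t) t) :
    HasDerivAt (fun s => (max (u s) 0) ^ p * φ s ^ r)
      (p * (max (u t) 0) ^ (p - 1) * v t * φ t ^ r +
        (max (u t) 0) ^ p * (V t * r * φ t ^ (r - 1))) t :=
  ((hasDerivAt_max_rpow hp (u t)).comp t hu).mul (hφ.rpow_const (Or.inl hpos.ne'))

/-- With `x = u`, `y = φ`, `m = φ'`, `s = u'`, this is the Picone inequality at the ratio `x / y`.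
The last product is the contribution of the equation for `φ`. -/
lemma calibration_deriv_le (hp : 1 < p) (ha : 0 < a) (hb : 0 < b) {x y m s : ℝ} (hy : 0 < y)
    (hx : 0 < x) :
    (p * x ^ (p - 1) * s * y ^ (1 - p) + x ^ p * (m * (1 - p) * y ^ (1 - p - 1))) * flux p a b m +
        x ^ p * y ^ (1 - p) * (-lam * y ^ (p - 1)) ≤ energy p a b s - lam * x ^ p ∧
      ((p * x ^ (p - 1) * s * y ^ (1 - p) + x ^ p * (m * (1 - p) * y ^ (1 - p - 1))) *
        flux p a b m + x ^ p * y ^ (1 - p) * (-lam * y ^ (p - 1)) =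
          energy p a b s - lam * x ^ p → s = m * (x / y)) := by
  have h := picone_energy hp ha hb (div_pos hx hy) m s
  have e1 : y ^ (1 - p) * y ^ (p - 1) = 1 := by
    rw [← Real.rpow_add hy, sub_add_sub_cancel, sub_self, Real.rpow_zero]
  have e2 : (x / y) ^ p = x ^ p * y ^ (1 - p - 1) := by
    rw [Real.div_rpow hx.le hy.le, div_eq_mul_inv, ← Real.rpow_neg hy.le]
    congr 2
    ring
  have e3 : (x / y) ^ (p - 1) = x ^ (p - 1) * y ^ (1 - p) := by
    rw [Real.div_rpow hx.le hy.le, div_eq_mul_inv, ← Real.rpow_neg hy.le, neg_sub]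
  have key : (p * x ^ (p - 1) * s * y ^ (1 - p) + x ^ p * (m * (1 - p) * y ^ (1 - p - 1))) *
        flux p a b m + x ^ p * y ^ (1 - p) * (-lam * y ^ (p - 1)) =
      (1 - p) * (x / y) ^ p * energy p a b m + p * (x / y) ^ (p - 1) * flux p a b m * s -
        lam * x ^ p := by
    rw [e2, e3, ← flux_mul_self hp m]
    linear_combination (-lam * x ^ p) * e1
  rw [key]
  exact ⟨by linarith [h.1], fun h' => h.2 (by linarith)⟩

/-- The one-sided eigenvalue inequality, with its equality case. -/
theorem calibration_bound (hp : 1 < p) (ha : 0 < a) (hb : 0 < b) (hL : 0 < L)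
    (hφ : IsProfile p a b L lam φ V) (hu : IsPrimitive L u v) (huL : u L = 0)
    (hv : MemLp v (ENNReal.ofReal p) (volume.restrict (Ioo 0 L))) :
    lam * ∫ t in Ioo 0 L, (max (u t) 0) ^ p ≤
        ∫ t in Ioo 0 L ∩ u ⁻¹' Ioi 0, energy p a b (v t) ∧
      (lam * ∫ t in Ioo 0 L, (max (u t) 0) ^ p =
        ∫ t in Ioo 0 L ∩ u ⁻¹' Ioi 0, energy p a b (v t) →
          ∃ k, 0 ≤ k ∧ ∀ t ∈ Ioo 0 L, max (u t) 0 = k * φ t) := by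
  have hp0 : 0 < p := by linarith
  have huc := hu.continuousOn hL.le
  set A := Ioo 0 L ∩ u ⁻¹' Ioi 0 with hA
  have hAo : IsOpen A := (huc.mono Ioo_subset_Icc_self).isOpen_inter_preimage isOpen_Ioo isOpen_Ioi
  -- Energy is counted only where `u > 0`, so that the bounds for `u` and `-u` can later be added
  -- without overlap.
  set Q : ℝ → ℝ := fun t => A.indicator (fun t => energy p a b (v t)) t -
    lam * (max (u t) 0) ^ p with hQ
  have hi1 : IntegrableOn (A.indicator fun t => energy p a b (v t)) (Ioo 0 L) :=
    (integrableOn_energy hp ha hb hv).indicator hAo.measurableSet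
  have hi2 : IntegrableOn (fun t => lam * (max (u t) 0) ^ p) (Ioo 0 L) := by
    refine (ContinuousOn.integrableOn_Icc ?_).mono_set Ioo_subset_Icc_self
    exact continuousOn_const.mul ((huc.sup continuousOn_const).rpow_const fun _ _ => Or.inr hp0.le)
  have hQi : IntervalIntegrable Q volume 0 L := by
    rw [intervalIntegrable_iff_integrableOn_Ioo_of_le hL.le]
    exact hi1.sub hi2
  have hQtot : ∫ t in (0 : ℝ)..L, Q t =
      (∫ t in A, energy p a b (v t)) - lam * ∫ t in Ioo 0 L, (max (u t) 0) ^ p := by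
    rw [← setIntegral_Ioo_eq hL.le, hQ, integral_sub hi1 hi2, integral_const_mul,
      setIntegral_indicator hAo.measurableSet, hA, ← inter_assoc, inter_self]
  set G := calibration p a b φ V u with hG
  set G' : ℝ → ℝ := fun t => (p * (max (u t) 0) ^ (p - 1) * v t * φ t ^ (1 - p) +
    (max (u t) 0) ^ p * (V t * (1 - p) * φ t ^ (1 - p - 1))) * flux p a b (V t) +
    (max (u t) 0) ^ p * φ t ^ (1 - p) * (-lam * φ t ^ (p - 1)) with hG'
  have hGac : ∀ c d, 0 < c → c ≤ d → d < L → AbsolutelyContinuousOnInterval G c d := by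
    intro c d hc hcd hd
    exact ((hu.ac_max_rpow hp hc hcd hd).fun_mul (hφ.ac_rpow _ hc hcd hd)).fun_mul
      (hφ.contDiff_flux hp).contDiffOn.absolutelyContinuousOnInterval
  have hud := hu.ae_hasDerivAt hL.le
  have hGd : ∀ᵐ t, t ∈ Ioo 0 L → HasDerivAt G (G' t) t := by
    filter_upwards [hud] with t ht htm
    have h := (hasDerivAt_max_rpow_mul_rpow hp (1 - p) (hφ.hasDerivAt t) (hφ.pos t htm)
      (ht htm)).mul (hφ.hasDerivAt_flux t)
    rw [max_eq_left (hφ.pos t htm).le] at h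
    exact h
  have hD : ∀ t ∈ Ioo 0 L, 0 ≤ Q t - G' t ∧
      (Q t - G' t = 0 → 0 < u t → v t = V t * (u t / φ t)) := by
    intro t ht
    rcases lt_or_ge 0 (u t) with hut | hut
    · have h := calibration_deriv_le (lam := lam) (m := V t) (s := v t) hp ha hb (hφ.pos t ht) hut
      simp only [hQ, hG', max_eq_left hut.le, indicator_of_mem (show t ∈ A from ⟨ht, hut⟩)]
      exact ⟨sub_nonneg.2 h.1, fun h' _ => h.2 (by linarith)⟩
    · have htA : t ∉ A := fun h' => absurd h'.2 (not_lt.2 hut)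
      simp only [hQ, hG', max_eq_right hut, indicator_of_notMem htA,
        Real.zero_rpow hp0.ne', Real.zero_rpow (show p - 1 ≠ 0 by linarith)]
      exact ⟨by simp, fun _ h' => absurd h' (not_lt.2 hut)⟩
  have hsubI : ∀ {c d}, 0 < c → c ≤ d → d < L → uIcc c d ⊆ uIcc 0 L := by
    intro c d hc hcd hd
    rw [uIcc_of_le hcd, uIcc_of_le hL.le]
    exact Icc_subset_Icc hc.le hd.le
  have hGI : ∀ {c d}, 0 < c → c ≤ d → d < L →
      IntervalIntegrable G' volume c d ∧ ∫ t in c..d, G' t = G d - G c := by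
    intro c d hc hcd hd
    refine ac_integral_eq_sub hcd (hGac c d hc hcd hd) ?_
    filter_upwards [hGd] with t ht htm
    exact ht ⟨hc.trans htm.1, htm.2.trans hd⟩
  have hDi : ∀ {c d}, 0 < c → c ≤ d → d < L →
      IntervalIntegrable (fun t => Q t - G' t) volume c d := fun hc hcd hd =>
    (hQi.mono_set (hsubI hc hcd hd)).sub (hGI hc hcd hd).1
  have hR0 : ∀ {c d}, 0 < c → c ≤ d → d < L → 0 ≤ ∫ t in c..d, (Q t - G' t) := by
    intro c d hc hcd hd
    exact intervalIntegral.integral_nonneg hcd fun t ht =>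
      (hD t ⟨hc.trans_le ht.1, ht.2.trans_lt hd⟩).1
  -- `φ ^ (1 - p)` is singular at the endpoints, so the fundamental theorem is used only on `[ε, L -
  -- ε]`; the boundary values of `G` disappear in the limit.
  have hlim : Tendsto (fun ε => ∫ t in ε..(L - ε), (Q t - G' t)) (𝓝[>] 0)
      (𝓝 (∫ t in (0 : ℝ)..L, Q t)) := by
    have hP := continuousOn_primitive_Icc hL.le hQi
    have h1 := (hP L (right_mem_Icc.2 hL.le)).tendsto.comp (tendsto_sub_nhdsGT L hL)
    have h2 := (hP 0 (left_mem_Icc.2 hL.le)).tendsto.comp (tendsto_nhdsGT_Icc hL)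
    have h3 := tendsto_calibration_left hp hL hφ hu hv
    have h4 := tendsto_calibration_right hp hL hφ hu huL hv
    have h5 := (h1.sub h2).sub (h4.sub h3)
    simp only [intervalIntegral.integral_same, sub_zero] at h5
    refine h5.congr' ?_
    filter_upwards [Ioo_mem_nhdsGT (half_pos hL)] with ε hε
    have hc : 0 < ε := hε.1
    have hcd : ε ≤ L - ε := by linarith [hε.2]
    have hd : L - ε < L := by linarith
    rw [intervalIntegral.integral_sub (hQi.mono_set (hsubI hc hcd hd)) (hGI hc hcd hd).1,
      (hGI hc hcd hd).2]
    simp only [Function.comp]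
    rw [intervalIntegral.integral_interval_sub_left]
    · refine hQi.mono_set ?_
      rw [uIcc_of_le (by linarith), uIcc_of_le hL.le]
      exact Icc_subset_Icc_right hd.le
    · refine hQi.mono_set ?_
      rw [uIcc_of_le hc.le, uIcc_of_le hL.le]
      exact Icc_subset_Icc_right (by linarith)
  -- The integrand is nonnegative, so an integral over a compact subinterval cannot exceed the limit
  -- over exhausting intervals.
  have hRle : ∀ {c d}, 0 < c → c ≤ d → d < L →
      ∫ t in c..d, (Q t - G' t) ≤ ∫ t in (0 : ℝ)..L, Q t := by
    intro c d hc hcd hd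
    refine ge_of_tendsto hlim ?_
    filter_upwards [Ioo_mem_nhdsGT hc, Ioo_mem_nhdsGT (sub_pos.2 hd)] with ε h1 h2
    have hε2 : d ≤ L - ε := by linarith [h2.2]
    have e1 := hR0 h1.1 h1.2.le (by linarith : c < L)
    have e2 := hR0 (hc.trans_le hcd) hε2 (by linarith [h1.1])
    have i1 := hDi h1.1 h1.2.le (by linarith : c < L)
    have i2 := hDi hc hcd hd
    have i3 := hDi (hc.trans_le hcd) hε2 (by linarith [h1.1])
    rw [← intervalIntegral.integral_add_adjacent_intervals i1 (i2.trans i3),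
      ← intervalIntegral.integral_add_adjacent_intervals i2 i3]
    linarith
  refine ⟨?_, fun heq => ?_⟩
  -- The degenerate interval `c = d = L / 2` already gives `0 ≤ ∫ Q`.
  · have := hRle (half_pos hL) le_rfl (half_lt_self hL)
    rw [intervalIntegral.integral_same, hQtot] at this
    linarith
  · rw [← heq, sub_self] at hQtot
    have hDz : ∀ {c d}, 0 < c → c ≤ d → d < L →
        ∀ᵐ t, t ∈ Ioo c d → Q t - G' t = 0 := by
      intro c d hc hcd hd
      have h0 : ∫ t in c..d, (Q t - G' t) = 0 :=
        le_antisymm ((hRle hc hcd hd).trans hQtot.le) (hR0 hc hcd hd)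
      rw [intervalIntegral.integral_of_le hcd, integral_Ioc_eq_integral_Ioo,
        setIntegral_eq_zero_iff_of_nonneg_ae ?_ ?_] at h0
      · rw [EventuallyEq, ae_restrict_iff' measurableSet_Ioo] at h0
        exact h0
      · rw [EventuallyLE, ae_restrict_iff' measurableSet_Ioo]
        exact Eventually.of_forall fun t ht => (hD t ⟨hc.trans ht.1, ht.2.trans hd⟩).1
      · rw [← intervalIntegrable_iff_integrableOn_Ioo_of_le hcd]
        exact hDi hc hcd hd
    -- Equality in Picone forces `v = V * u / φ` a.e. where `u > 0`. Hence the absolutely continuous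
    -- function `(u⁺ / φ) ^ p` has derivative zero a.e. and is constant.
    have hKc : ∀ {c d}, 0 < c → c ≤ d → d < L →
        (max (u d) 0) ^ p * φ d ^ (-p) = (max (u c) 0) ^ p * φ c ^ (-p) := by
      intro c d hc hcd hd
      have h := (ac_integral_eq_sub (f' := fun _ => 0) hcd
        ((hu.ac_max_rpow hp hc hcd hd).fun_mul (hφ.ac_rpow (-p) hc hcd hd)) ?_).2
      · simp only [intervalIntegral.integral_zero] at h
        linarith
      · filter_upwards [hud, hDz hc hcd hd] with t ht1 ht2 htm
        have htm' : t ∈ Ioo 0 L := ⟨hc.trans htm.1, htm.2.trans hd⟩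
        have hpos := hφ.pos t htm'
        refine (hasDerivAt_max_rpow_mul_rpow hp (-p) (hφ.hasDerivAt t) hpos
          (ht1 htm')).congr_deriv ?_
        rcases lt_or_ge 0 (u t) with hut | hut
        · rw [(hD t htm').2 (ht2 htm) hut, max_eq_left hut.le, Real.rpow_sub_one hpos.ne',
            Real.rpow_sub_one hut.ne']
          field_simp
          ring
        · rw [max_eq_right hut, Real.zero_rpow hp0.ne', Real.zero_rpow (by linarith)]
          ring
    set K := (max (u (L / 2)) 0) ^ p * φ (L / 2) ^ (-p) with hK
    have hmid : L / 2 ∈ Ioo 0 L := ⟨half_pos hL, half_lt_self hL⟩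
    have hKall : ∀ t ∈ Ioo 0 L, (max (u t) 0) ^ p * φ t ^ (-p) = K := by
      intro t ht
      rcases le_total t (L / 2) with h | h
      · exact (hKc ht.1 h hmid.2).symm
      · exact hKc hmid.1 h ht.2
    have hK0 : 0 ≤ K := mul_nonneg (Real.rpow_nonneg (le_max_right _ _) _)
      (Real.rpow_nonneg (hφ.pos _ hmid).le _)
    refine ⟨K ^ (1 / p), Real.rpow_nonneg hK0 _, fun t ht => ?_⟩
    have hpos := hφ.pos t ht
    have hm : 0 ≤ max (u t) 0 := le_max_right _ _
    rw [← hKall t ht, Real.rpow_neg hpos.le, ← div_eq_mul_inv, ← Real.div_rpow hm hpos.le,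
      ← Real.rpow_mul (div_nonneg hm hpos.le), mul_one_div_cancel hp0.ne', Real.rpow_one,
      div_mul_cancel₀ _ hpos.ne']

end Calibration

/-! ### Variational characterization and the eigenfunctions -/

section Eigenfunctions

variable {p a b L lam : ℝ} {φ φ' V V' u v : ℝ → ℝ}

lemma continuousOn_abs_rpow (hp : 1 < p) (hu : ContinuousOn u (Icc 0 L)) :
    ContinuousOn (fun t => |u t| ^ p) (Icc 0 L) :=
  hu.abs.rpow_const fun _ _ => Or.inr (by linarith)

lemma integral_abs_rpow_pos (hp : 1 < p) (hL : 0 < L) (hu : ContinuousOn u (Icc 0 L))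
    (hne : ∃ t ∈ Icc 0 L, u t ≠ 0) : 0 < ∫ t in Ioo 0 L, |u t| ^ p := by
  obtain ⟨t, ht, hut⟩ := hne
  rw [setIntegral_Ioo_eq hL.le]
  exact intervalIntegral.integral_pos hL (continuousOn_abs_rpow hp hu)
    (fun _ _ => Real.rpow_nonneg (abs_nonneg _) _)
    ⟨t, ht, Real.rpow_pos_of_pos (abs_pos.2 hut) _⟩

/-- The sharp lower bound of the energy, with its equality case. -/
theorem lam_mul_integral_le_energy (hp : 1 < p) (ha : 0 < a) (hb : 0 < b) (hL : 0 < L)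
    (hφ : IsProfile p a b L lam φ V) (hφ' : IsProfile p b a L lam φ' V') (hu : MemW₀ p L u v) :
    lam * ∫ t in Ioo 0 L, |u t| ^ p ≤ ∫ t in Ioo 0 L, energy p a b (v t) ∧
      ((∃ t ∈ Icc 0 L, u t ≠ 0) →
        lam * ∫ t in Ioo 0 L, |u t| ^ p = ∫ t in Ioo 0 L, energy p a b (v t) →
        ∃ c, 0 < c ∧ ((∀ t ∈ Icc 0 L, u t = c * φ t) ∨ ∀ t ∈ Icc 0 L, u t = c * -φ' t)) := by
  have hp0 : 0 < p := by linarith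
  have huc := hu.continuousOn
  have hunc : ContinuousOn (fun t => -u t) (Icc 0 L) := huc.neg
  have hprim := hu.isPrimitive hp hL
  have h1 := calibration_bound hp ha hb hL hφ hprim hu.right hu.memLp_deriv
  have h2 := calibration_bound hp hb ha hL hφ' hprim.neg (by simp [hu.right])
    hu.memLp_deriv.neg
  simp only [energy_neg] at h2
  have hopen : ∀ {w : ℝ → ℝ}, ContinuousOn w (Icc 0 L) → IsOpen (Ioo 0 L ∩ w ⁻¹' Ioi 0) :=
    fun hw => (hw.mono Ioo_subset_Icc_self).isOpen_inter_preimage isOpen_Ioo isOpen_Ioi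
  have hiE := integrableOn_energy hp ha hb hu.memLp_deriv
  -- The sets `{u > 0}` and `{u < 0}` are disjoint, and the energy on `{u = 0}` is nonnegative and
  -- may be dropped.
  have hE : (∫ t in Ioo 0 L ∩ u ⁻¹' Ioi 0, energy p a b (v t)) +
      (∫ t in Ioo 0 L ∩ (fun t => -u t) ⁻¹' Ioi 0, energy p a b (v t)) ≤
      ∫ t in Ioo 0 L, energy p a b (v t) := by
    rw [← setIntegral_union ?_ (hopen hunc).measurableSet (hiE.mono_set inter_subset_left)
      (hiE.mono_set inter_subset_left)]
    · refine setIntegral_mono_set hiE ?_ ?_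
      · exact Filter.Eventually.of_forall fun t => energy_nonneg ha hb _
      · exact (union_subset inter_subset_left inter_subset_left).eventuallyLE
    · refine Set.disjoint_left.2 fun t h h' => ?_
      have e1 : 0 < u t := h.2
      have e2 : 0 < -u t := h'.2
      linarith
  have hN : ∫ t in Ioo 0 L, |u t| ^ p =
      (∫ t in Ioo 0 L, (max (u t) 0) ^ p) + ∫ t in Ioo 0 L, (max (-u t) 0) ^ p := by
    have hi : ∀ {w : ℝ → ℝ}, ContinuousOn w (Icc 0 L) →
        IntegrableOn (fun t => (max (w t) 0) ^ p) (Ioo 0 L) := fun hw =>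
      (ContinuousOn.integrableOn_Icc ((hw.sup continuousOn_const).rpow_const
        fun _ _ => Or.inr hp0.le)).mono_set Ioo_subset_Icc_self
    rw [← integral_add (hi huc) (hi hunc)]
    congr 1
    funext t
    rcases le_total 0 (u t) with h | h
    · rw [abs_of_nonneg h, max_eq_left h, max_eq_right (by linarith), Real.zero_rpow hp0.ne',
        add_zero]
    · rw [abs_of_nonpos h, max_eq_right h, max_eq_left (by linarith), Real.zero_rpow hp0.ne',
        zero_add]
  rw [hN, mul_add]
  refine ⟨by linarith [h1.1, h2.1], fun hne heq => ?_⟩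
  obtain ⟨k₁, hk₁, H₁⟩ := h1.2 (by linarith [h1.1, h2.1])
  obtain ⟨k₂, hk₂, H₂⟩ := h2.2 (by linarith [h1.1, h2.1])
  have hend : ∀ {ψ : ℝ → ℝ} {c : ℝ}, ψ 0 = 0 → ψ L = 0 → (∀ t ∈ Ioo 0 L, u t = c * ψ t) →
      ∀ t ∈ Icc 0 L, u t = c * ψ t := by
    intro ψ c hψ0 hψL h t ht
    rcases ht.1.eq_or_lt with h0 | h0
    · rw [← h0, hu.left, hψ0, mul_zero]
    rcases ht.2.eq_or_lt with h3 | h3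
    · rw [h3, hu.right, hψL, mul_zero]
    exact h t ⟨h0, h3⟩
  -- If `k₁ = 0` then `u ≤ 0` and only the negative profile survives; if `k₁ > 0` then `u` is
  -- positive throughout `(0, L)`.
  rcases hk₁.eq_or_lt with h0 | hpos
  · have hneg : ∀ t ∈ Ioo 0 L, u t = k₂ * -φ' t := by
      intro t ht
      have e1 := H₁ t ht
      have e2 := H₂ t ht
      rw [← h0, zero_mul] at e1
      have e3 : u t ≤ 0 := e1 ▸ le_max_left (u t) 0
      rw [max_eq_left (by linarith)] at e2
      linarith
    have hneg' := hend (ψ := fun t => -φ' t) (by simp [hφ'.left]) (by simp [hφ'.right]) hneg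
    refine ⟨k₂, lt_of_le_of_ne hk₂ fun h => ?_, Or.inr hneg'⟩
    obtain ⟨t, ht, hut⟩ := hne
    exact hut (by rw [hneg' t ht, ← h, zero_mul])
  · refine ⟨k₁, hpos, Or.inl (hend hφ.left hφ.right fun t ht => ?_)⟩
    have e1 := H₁ t ht
    have e2 : 0 < max (u t) 0 := e1 ▸ mul_pos hpos (hφ.pos t ht)
    rcases lt_max_iff.1 e2 with h | h
    · rwa [max_eq_left h.le] at e1
    · exact absurd h (lt_irrefl _)

lemma IsProfile.memW₀ (hL : 0 < L) (hφ : IsProfile p a b L lam φ V) {c : ℝ}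
    (hu : ∀ t ∈ Icc 0 L, u t = c * φ t) : MemW₀ p L u (fun t => c * V t) := by
  have hVc : Continuous fun t => c * V t := continuous_const.mul hφ.continuous_deriv
  have hprim : IsPrimitive L u (fun t => c * V t) := by
    refine ⟨hVc.intervalIntegrable _ _, fun t ht => ?_⟩
    rw [intervalIntegral.integral_eq_sub_of_hasDerivAt
      (fun s _ => (hφ.hasDerivAt s).const_mul c) (hVc.intervalIntegrable _ _), hφ.left, hu t ht]
    ring
  refine hprim.memW₀ hL.le (by rw [hu L (right_mem_Icc.2 hL.le), hφ.right, mul_zero]) ?_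
  obtain ⟨M, hM⟩ := isCompact_Icc.exists_bound_of_continuousOn (s := Icc 0 L) hVc.continuousOn
  refine MemLp.of_bound hVc.aestronglyMeasurable M ?_
  rw [ae_restrict_iff' measurableSet_Ioo]
  exact Filter.Eventually.of_forall fun t ht => hM t (Ioo_subset_Icc_self ht)

/-- The flux of a profile is `C¹`, so integration by parts turns the classical equation into the
weak one. The flux and the right-hand side are both homogeneous of degree `p - 1`, which absorbs
`c`. -/
theorem IsProfile.isEigenfunction (hp : 1 < p) (hL : 0 < L) (hφ : IsProfile p a b L lam φ V)
    {c : ℝ} (hc : 0 < c) (hu : ∀ t ∈ Icc 0 L, u t = c * φ t) :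
    IsEigenfunction p a b L lam u := by
  refine ⟨⟨L / 2, ⟨by linarith, by linarith⟩, ?_⟩, fun t => c * V t, hφ.memW₀ hL hu, ?_⟩
  · rw [hu _ ⟨by linarith, by linarith⟩]
    exact (mul_pos hc (hφ.pos _ ⟨half_pos hL, half_lt_self hL⟩)).ne'
  · intro ζ ψ hζ
    have hF : ∀ t, HasDerivAt (fun t => flux p a b (c * V t))
        (c ^ (p - 1) * (-lam * (max (φ t) 0) ^ (p - 1))) t := by
      intro t
      simp only [flux_mul hc.le]
      exact (hφ.hasDerivAt_flux t).const_mul _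
    have h := (hζ.isPrimitive hp hL).integral_mul_deriv hL.le (by rw [hζ.right, zero_mul]) hF
      (continuous_const.mul (hφ.continuous_deriv_flux hp))
    have e1 : ∫ t in Ioo 0 L, flux p a b (c * V t) * ψ t =
        ∫ t in Ioo 0 L, ψ t * flux p a b (c * V t) := by simp only [mul_comm]
    rw [e1, ← neg_eq_iff_eq_neg.2 h, ← integral_neg, ← integral_const_mul]
    refine setIntegral_congr_fun measurableSet_Ioo fun t ht => ?_
    have hpos := hφ.pos t ht
    have hcp := mul_pos hc hpos
    rw [hu t (Ioo_subset_Icc_self ht), abs_of_pos hcp, max_eq_left hpos.le]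
    have e2 : (c * φ t) ^ (p - 2) * (c * φ t) = c ^ (p - 1) * φ t ^ (p - 1) := by
      rw [← Real.rpow_add_one hcp.ne', ← Real.mul_rpow hc.le hpos.le]
      congr 1
      ring
    rw [e2]
    ring

lemma MemW₀.neg (h : MemW₀ p L u v) : MemW₀ p L (fun t => -u t) (fun t => -v t) where
  continuousOn := h.continuousOn.neg
  left := by simp [h.left]
  right := by simp [h.right]
  memLp_deriv := h.memLp_deriv.neg
  weak_deriv η hη := by
    simp only [neg_mul, integral_neg, h.weak_deriv η hη]

lemma IsEigenfunction.neg (h : IsEigenfunction p b a L lam u) :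
    IsEigenfunction p a b L lam (fun t => -u t) := by
  obtain ⟨⟨t, ht, hut⟩, v, hv, H⟩ := h
  refine ⟨⟨t, ht, neg_ne_zero.2 hut⟩, fun t => -v t, hv.neg, fun ζ ψ hζ => ?_⟩
  simp only [flux_neg, neg_mul, integral_neg, abs_neg, mul_neg, H ζ ψ hζ]

lemma abs_rpow_sub_two_mul (hp : 1 < p) (x : ℝ) : |x| ^ (p - 2) * x * x = |x| ^ p := by
  rcases eq_or_ne x 0 with rfl | h
  · rw [abs_zero, Real.zero_rpow (by linarith : p ≠ 0), mul_zero]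
  · have hx := abs_pos.2 h
    rw [mul_assoc, ← abs_mul_abs_self x, ← mul_assoc, ← Real.rpow_add_one hx.ne',
      ← Real.rpow_add_one hx.ne']
    congr 1
    ring

lemma integral_energy_of_weak_form (hp : 1 < p) {lam' : ℝ} (hu : MemW₀ p L u v)
    (H : ∀ φ ψ : ℝ → ℝ, MemW₀ p L φ ψ →
      ∫ t in Ioo 0 L, flux p a b (v t) * ψ t =
        lam' * ∫ t in Ioo 0 L, |u t| ^ (p - 2) * u t * φ t) :
    ∫ t in Ioo 0 L, energy p a b (v t) = lam' * ∫ t in Ioo 0 L, |u t| ^ p := by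
  have := H u v hu
  simpa only [flux_mul_self hp, abs_rpow_sub_two_mul hp] using this

/-- Testing the weak equation with `u` itself puts `u` in the equality case of the sharp energy
bound. -/
theorem isEigenfunction_iff (hp : 1 < p) (ha : 0 < a) (hb : 0 < b) (hL : 0 < L)
    (hφ : IsProfile p a b L lam φ V) (hφ' : IsProfile p b a L lam φ' V') :
    IsEigenfunction p a b L lam u ↔
      ∃ c, 0 < c ∧ ((∀ t ∈ Icc 0 L, u t = c * φ t) ∨ ∀ t ∈ Icc 0 L, u t = c * -φ' t) := by
  constructor
  · rintro ⟨hne, v, hv, H⟩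
    exact (lam_mul_integral_le_energy hp ha hb hL hφ hφ' hv).2 hne
      (integral_energy_of_weak_form hp hv H).symm
  · rintro ⟨c, hc, h | h⟩
    · exact hφ.isEigenfunction hp hL hc h
    · have := (hφ'.isEigenfunction (u := fun t => -u t) hp hL hc
        (fun t ht => by simp [h t ht])).neg
      simpa using this

/-- The energy of an eigenfunction is its eigenvalue times the positive number `∫ |u| ^ p`, so the
sharp bound compares the two eigenvalues. -/
lemma isLeast_dirichletSpectrum (hp : 1 < p) (ha : 0 < a) (hb : 0 < b) (hL : 0 < L)
    (hφ : IsProfile p a b L lam φ V) (hφ' : IsProfile p b a L lam φ' V') :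
    IsLeast (dirichletSpectrum p a b L) lam := by
  refine ⟨⟨φ, hφ.isEigenfunction hp hL one_pos fun t _ => (one_mul _).symm⟩, ?_⟩
  rintro lam' ⟨u, hne, v, hv, H⟩
  have h := (lam_mul_integral_le_energy hp ha hb hL hφ hφ' hv).1
  rw [integral_energy_of_weak_form hp hv H] at h
  exact le_of_mul_le_mul_right h (integral_abs_rpow_pos hp hL hv.continuousOn hne)

lemma pNorm_eq_one_iff (hp : 1 < p) : pNorm p L u = 1 ↔ ∫ t in Ioo 0 L, |u t| ^ p = 1 := by
  have h0 : 0 ≤ ∫ t in Ioo 0 L, |u t| ^ p :=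
    integral_nonneg fun _ => Real.rpow_nonneg (abs_nonneg _) _
  unfold pNorm
  constructor
  · intro h
    have := congrArg (· ^ p) h
    simpa [← Real.rpow_mul h0, inv_mul_cancel₀ (show p ≠ 0 by linarith)] using this
  · intro h
    rw [h, Real.one_rpow]

lemma integral_abs_mul_rpow {c : ℝ} (hc : 0 ≤ c) (hu : ∀ t ∈ Icc 0 L, u t = c * φ t) :
    ∫ t in Ioo 0 L, |u t| ^ p = c ^ p * ∫ t in Ioo 0 L, |φ t| ^ p := by
  rw [← integral_const_mul]
  refine setIntegral_congr_fun measurableSet_Ioo fun t ht => ?_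
  rw [hu t (Ioo_subset_Icc_self ht), abs_mul, abs_of_nonneg hc, Real.mul_rpow hc (abs_nonneg _)]

lemma exists_pNorm_eq_one (hp : 1 < p) (hL : 0 < L) (hφ : ContinuousOn φ (Icc 0 L))
    (hne : ∃ t ∈ Icc 0 L, φ t ≠ 0) : ∃ c, 0 < c ∧ pNorm p L (fun t => c * φ t) = 1 := by
  have hI := integral_abs_rpow_pos hp hL hφ hne
  set I := ∫ t in Ioo 0 L, |φ t| ^ p with hIdef
  have hc : 0 < I ^ (-(1 / p)) := Real.rpow_pos_of_pos hI _
  refine ⟨I ^ (-(1 / p)), hc, (pNorm_eq_one_iff hp).2 ?_⟩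
  rw [integral_abs_mul_rpow hc.le fun _ _ => rfl, ← hIdef, ← Real.rpow_mul hI.le, neg_mul,
    one_div_mul_cancel (by linarith), Real.rpow_neg_one, inv_mul_cancel₀ hI.ne']

lemma IsProfile.exists_ne_zero (hL : 0 < L) (hφ : IsProfile p a b L lam φ V) :
    ∃ t ∈ Icc 0 L, φ t ≠ 0 :=
  ⟨L / 2, ⟨by linarith, by linarith⟩, (hφ.pos _ ⟨half_pos hL, half_lt_self hL⟩).ne'⟩

lemma firstEigenvalue_eq_of_isProfile (hp : 1 < p) (ha : 0 < a) (hb : 0 < b) (hL : 0 < L)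
    (hφ : IsProfile p a b L lam φ V) (hφ' : IsProfile p b a L lam φ' V') :
    firstEigenvalue p a b L = lam := by
  refine IsLeast.csInf_eq ⟨?_, ?_⟩
  · obtain ⟨c, hc, hn⟩ := exists_pNorm_eq_one hp hL hφ.continuous.continuousOn
      (hφ.exists_ne_zero hL)
    obtain ⟨-, v, hv, H⟩ := hφ.isEigenfunction (u := fun t => c * φ t) hp hL hc fun _ _ => rfl
    refine ⟨_, v, hv, hn, ?_⟩
    have h := integral_energy_of_weak_form hp hv H
    rw [(pNorm_eq_one_iff hp).1 hn, mul_one] at h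
    exact h.symm
  · rintro r ⟨u, v, hv, hn, rfl⟩
    have h := (lam_mul_integral_le_energy hp ha hb hL hφ hφ' hv).1
    rw [(pNorm_eq_one_iff hp).1 hn, mul_one] at h
    exact h

end Eigenfunctions

/-! ### The classical operator as the case a = b = 1 -/

section Classical

variable {p L : ℝ}

lemma energy_one_one (hp : 1 < p) (s : ℝ) : energy p 1 1 s = |s| ^ p := by
  rcases le_total 0 s with h | h
  · rw [energy_of_nonneg hp h, abs_of_nonneg h, Real.one_rpow, one_mul]
  · rw [← neg_neg s, energy_neg, energy_of_nonneg hp (by linarith), abs_neg,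
      abs_of_nonneg (by linarith), Real.one_rpow, one_mul]

lemma flux_self (hp : 1 < p) {a : ℝ} (s : ℝ) : flux p a a s = a ^ p * classicalFlux p s := by
  have key : ∀ {s : ℝ}, 0 ≤ s → flux p a a s = a ^ p * classicalFlux p s := by
    intro s h
    rw [flux_of_nonneg hp h, classicalFlux, abs_of_nonneg h]
    rcases h.eq_or_lt with rfl | h
    · simp [Real.zero_rpow (by linarith : p - 1 ≠ 0)]
    · rw [← Real.rpow_add_one h.ne']
      ring_nf
  rcases le_total 0 s with h | h
  · exact key h
  · have := key (s := -s) (by linarith)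
    rw [flux_neg, classicalFlux, abs_neg] at this
    rw [classicalFlux]
    linarith

lemma classicalFlux_eq (hp : 1 < p) (s : ℝ) : classicalFlux p s = flux p 1 1 s := by
  rw [flux_self hp, Real.one_rpow, one_mul]

lemma isClassicalEigenfunction_iff (hp : 1 < p) {lam : ℝ} {u : ℝ → ℝ} :
    IsClassicalEigenfunction p L lam u ↔ IsEigenfunction p 1 1 L lam u := by
  unfold IsClassicalEigenfunction IsEigenfunction
  simp only [classicalFlux_eq hp]

lemma classicalFirstEigenvalue_eq (hp : 1 < p) :
    classicalFirstEigenvalue p L = firstEigenvalue p 1 1 L := by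
  unfold classicalFirstEigenvalue firstEigenvalue
  simp only [← energy_one_one hp]
  rfl

lemma lamValue_one_one (p L : ℝ) : lamValue p 1 1 L = (p - 1) * (piP p / L) ^ p := by
  unfold lamValue
  norm_num

end Classical

/-! ### First eigenvalue and principal eigenfunction -/

section Profiles

variable {p a b L : ℝ} {S C : ℝ → ℝ}

lemma isProfile_profile_swap (hp : 1 < p) (ha : 0 < a) (hb : 0 < b) (hL : 0 < L)
    (hS : IsSinP p S C) :
    IsProfile p b a L (lamValue p a b L) (profile p b a L S) (profileDeriv p b a L C) := by
  rw [lamValue_comm]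
  exact isProfile_profile hp hb ha hL hS

theorem firstEigenvalue_eq (hp : 1 < p) (ha : 0 < a) (hb : 0 < b) (hL : 0 < L) :
    firstEigenvalue p a b L = lamValue p a b L := by
  obtain ⟨S, C, hS⟩ := exists_isSinP hp
  exact firstEigenvalue_eq_of_isProfile hp ha hb hL (isProfile_profile hp ha hb hL hS)
    (isProfile_profile_swap hp ha hb hL hS)

theorem isEigenfunction_firstEigenvalue_iff (hp : 1 < p) (ha : 0 < a) (hb : 0 < b) (hL : 0 < L)
    (hS : IsSinP p S C) {u : ℝ → ℝ} :
    IsEigenfunction p a b L (firstEigenvalue p a b L) u ↔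
      ∃ c, 0 < c ∧ ((∀ t ∈ Icc 0 L, u t = c * profile p a b L S t) ∨
        ∀ t ∈ Icc 0 L, u t = c * -profile p b a L S t) := by
  rw [firstEigenvalue_eq hp ha hb hL]
  exact isEigenfunction_iff hp ha hb hL (isProfile_profile hp ha hb hL hS)
    (isProfile_profile_swap hp ha hb hL hS)

lemma IsPrincipalEigenfunction.eq_profile (hp : 1 < p) (hS : IsSinP p S C) {φ : ℝ → ℝ}
    (hφ : IsPrincipalEigenfunction p φ) :
    ∃ c, 0 < c ∧ ∀ t ∈ Icc (0 : ℝ) 1, φ t = c * profile p 1 1 1 S t := by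
  obtain ⟨h1, hpos, -⟩ := hφ
  rw [isClassicalEigenfunction_iff hp, classicalFirstEigenvalue_eq hp,
    isEigenfunction_firstEigenvalue_iff hp one_pos one_pos one_pos hS] at h1
  obtain ⟨c, hc, h | h⟩ := h1
  · exact ⟨c, hc, h⟩
  · have e1 := hpos (1 / 2) ⟨by norm_num, by norm_num⟩
    have e2 := (isProfile_profile hp one_pos one_pos one_pos hS).pos (1 / 2)
      ⟨by norm_num, by norm_num⟩
    rw [h (1 / 2) ⟨by norm_num, by norm_num⟩] at e1
    nlinarith [mul_pos hc e2]

theorem exists_isPrincipalEigenfunction (hp : 1 < p) :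
    ∃ φ : ℝ → ℝ, IsPrincipalEigenfunction p φ := by
  obtain ⟨S, C, hS⟩ := exists_isSinP hp
  have hφ := isProfile_profile hp one_pos one_pos one_pos hS
  obtain ⟨c, hc, hn⟩ := exists_pNorm_eq_one hp one_pos hφ.continuous.continuousOn
    (hφ.exists_ne_zero one_pos)
  refine ⟨fun t => c * profile p 1 1 1 S t, ?_, fun t ht => mul_pos hc (hφ.pos t ht), hn⟩
  rw [isClassicalEigenfunction_iff hp, classicalFirstEigenvalue_eq hp,
    isEigenfunction_firstEigenvalue_iff hp one_pos one_pos one_pos hS]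
  exact ⟨c, hc, Or.inl fun _ _ => rfl⟩

/-- Both functions are positive multiples of the same profile, and the normalization determines the
multiple. -/
theorem IsPrincipalEigenfunction.eqOn (hp : 1 < p) {φ φ' : ℝ → ℝ}
    (hφ : IsPrincipalEigenfunction p φ) (hφ' : IsPrincipalEigenfunction p φ') :
    EqOn φ φ' (Icc 0 1) := by
  obtain ⟨S, C, hS⟩ := exists_isSinP hp
  obtain ⟨c, hc, h⟩ := hφ.eq_profile hp hS
  obtain ⟨c', hc', h'⟩ := hφ'.eq_profile hp hS
  have hψ := isProfile_profile hp one_pos one_pos one_pos hS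
  have hI := integral_abs_rpow_pos hp one_pos hψ.continuous.continuousOn
    (hψ.exists_ne_zero one_pos)
  have e1 := (pNorm_eq_one_iff hp).1 hφ.2.2
  have e2 := (pNorm_eq_one_iff hp).1 hφ'.2.2
  rw [integral_abs_mul_rpow hc.le h] at e1
  rw [integral_abs_mul_rpow hc'.le h'] at e2
  have e3 : c ^ p = c' ^ p := mul_right_cancel₀ hI.ne' (e1.trans e2.symm)
  have e4 : c = c' := (Real.rpow_left_inj hc.le hc'.le (by linarith)).1 e3
  intro t ht
  rw [h t ht, h' t ht, e4]

theorem isEigenfunction_iff_phi (hp : 1 < p) (ha : 0 < a) (hb : 0 < b) (hL : 0 < L)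
    {φ : ℝ → ℝ} (hφ : IsPrincipalEigenfunction p φ) (u : ℝ → ℝ) :
    IsEigenfunction p a b L (firstEigenvalue p a b L) u ↔
      ∃ c : ℝ, 0 < c ∧
        ((∀ t ∈ Icc 0 L, u t = c * phiPlus a b φ (t / L)) ∨
          (∀ t ∈ Icc 0 L, u t = c * phiMinus a b φ (t / L))) := by
  obtain ⟨S, C, hS⟩ := exists_isSinP hp
  obtain ⟨k, hk, h⟩ := hφ.eq_profile hp hS
  rw [isEigenfunction_firstEigenvalue_iff hp ha hb hL hS]
  have hplus : ∀ t ∈ Icc 0 L, phiPlus a b φ (t / L) = k * profile p a b L S t :=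
    fun t ht => phiPlus_eq_profile hp ha hb hL hS h ht
  have hminus : ∀ t ∈ Icc 0 L, phiMinus a b φ (t / L) = k * -profile p b a L S t := fun t ht => by
    rw [phiMinus_eq (by positivity), phiPlus_eq_profile hp hb ha hL hS h ht, mul_neg]
  constructor
  · rintro ⟨c, hc, H | H⟩
    · refine ⟨c / k, by positivity, Or.inl fun t ht => ?_⟩
      rw [hplus t ht, H t ht]
      field_simp
    · refine ⟨c / k, by positivity, Or.inr fun t ht => ?_⟩
      rw [hminus t ht, H t ht]
      field_simp
  · rintro ⟨c, hc, H | H⟩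
    · refine ⟨c * k, by positivity, Or.inl fun t ht => ?_⟩
      rw [H t ht, hplus t ht, mul_assoc]
    · refine ⟨c * k, by positivity, Or.inr fun t ht => ?_⟩
      rw [H t ht, hminus t ht, mul_assoc]

end Profiles

/-! ### Geometry of the set of eigenfunctions -/

section HalfLines

variable {p a b L : ℝ} {S C : ℝ → ℝ}

theorem eigenSet_eq (hp : 1 < p) (ha : 0 < a) (hb : 0 < b) (hL : 0 < L) (hS : IsSinP p S C) :
    eigenSet p a b L (firstEigenvalue p a b L) =
      halfLine ((Icc 0 L).domRestrict (profile p a b L S)) ∪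
        halfLine ((Icc 0 L).domRestrict fun t => -profile p b a L S t) := by
  ext f
  constructor
  · rintro ⟨u, hu, rfl⟩
    obtain ⟨c, hc, h | h⟩ := (isEigenfunction_firstEigenvalue_iff hp ha hb hL hS).1 hu
    · exact Or.inl ⟨c, hc, funext fun t => h t t.2⟩
    · exact Or.inr ⟨c, hc, funext fun t => h t t.2⟩
  · rintro (⟨c, hc, rfl⟩ | ⟨c, hc, rfl⟩)
    · exact ⟨fun t => c * profile p a b L S t,
        (isEigenfunction_firstEigenvalue_iff hp ha hb hL hS).2 ⟨c, hc, Or.inl fun _ _ => rfl⟩, rfl⟩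
    · exact ⟨fun t => c * -profile p b a L S t,
        (isEigenfunction_firstEigenvalue_iff hp ha hb hL hS).2 ⟨c, hc, Or.inr fun _ _ => rfl⟩, rfl⟩

/-- A line containing `f` and `2 • f` with `f ≠ 0` passes through the origin, so every other point
on it is a multiple of `f`. -/
lemma exists_eq_smul_of_collinear {f g : Icc (0 : ℝ) L → ℝ} (hf : f ≠ 0)
    (h : Collinear ℝ (halfLine f ∪ halfLine g)) : ∃ k : ℝ, g = k • f := by
  have hfm : f ∈ halfLine f ∪ halfLine g := Or.inl ⟨1, one_pos, (one_smul _ _).symm⟩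
  obtain ⟨w, hw⟩ := (collinear_iff_of_mem hfm).1 h
  obtain ⟨r, hr⟩ := hw ((2 : ℝ) • f) (Or.inl ⟨2, two_pos, rfl⟩)
  obtain ⟨s, hs⟩ := hw g (Or.inr ⟨1, one_pos, (one_smul _ _).symm⟩)
  rw [vadd_eq_add] at hr hs
  have hfr : f = r • w := by
    rw [two_smul] at hr
    exact add_right_cancel hr
  have hr0 : r ≠ 0 := by
    rintro rfl
    exact hf (by rw [hfr, zero_smul])
  refine ⟨s / r + 1, ?_⟩
  rw [add_smul, one_smul, hs]
  congr 1
  conv_rhs => rw [hfr]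
  rw [smul_smul, div_mul_cancel₀ _ hr0]

lemma domRestrict_profile_ne_zero (hp : 1 < p) (ha : 0 < a) (hb : 0 < b) (hL : 0 < L)
    (hS : IsSinP p S C) : (Icc 0 L).domRestrict (profile p a b L S) ≠ 0 := by
  intro h
  have h1 := congrFun h ⟨_, Ioo_subset_Icc_self (glue_mem_Ioo ha hb hL)⟩
  simp only [domRestrict_apply, Pi.zero_apply, profile_glue hp ha hb hL hS] at h1
  exact one_ne_zero h1

/-- Both profiles have maximum `1`, attained only at points that differ when `a ≠ b`. If the
negative one were `k` times the positive one, evaluation at the first maximum would give `k > -1`,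
and at the second `k < -1`. -/
theorem not_collinear_profile (hp : 1 < p) (ha : 0 < a) (hb : 0 < b) (hL : 0 < L)
    (hS : IsSinP p S C) (hab : a ≠ b) :
    ¬ Collinear ℝ (halfLine ((Icc 0 L).domRestrict (profile p a b L S)) ∪
        halfLine ((Icc 0 L).domRestrict fun t => -profile p b a L S t)) := by
  intro h
  obtain ⟨k, hk⟩ := exists_eq_smul_of_collinear (domRestrict_profile_ne_zero hp ha hb hL hS) h
  have hT := glue_mem_Ioo ha hb hL
  have hT' := glue_mem_Ioo hb ha hL
  have hne : L * a / (a + b) ≠ L * b / (b + a) := by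
    rw [add_comm b a]
    intro h
    rw [div_left_inj' (by positivity)] at h
    exact hab (mul_left_cancel₀ hL.ne' h)
  have e1 := congrFun hk ⟨_, Ioo_subset_Icc_self hT⟩
  have e2 := congrFun hk ⟨_, Ioo_subset_Icc_self hT'⟩
  simp only [domRestrict_apply, Pi.smul_apply, smul_eq_mul, profile_glue hp ha hb hL hS,
    profile_glue hp hb ha hL hS] at e1 e2
  have l1 := profile_lt_one hp hb ha hL hS hne
  have l2 := profile_lt_one hp ha hb hL hS hne.symm
  have p2 := (isProfile_profile hp ha hb hL hS).pos _ hT'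
  nlinarith

lemma domRestrict_profile_mem_C1 (hp : 1 < p) (ha : 0 < a) (hb : 0 < b) (hL : 0 < L)
    (hS : IsSinP p S C) : (Icc 0 L).domRestrict (profile p a b L S) ∈ C1 L :=
  ⟨_, (isProfile_profile hp ha hb hL hS).contDiff.contDiffOn, rfl⟩

lemma domRestrict_neg_profile_mem_C1 (hp : 1 < p) (ha : 0 < a) (hb : 0 < b) (hL : 0 < L)
    (hS : IsSinP p S C) : ((Icc 0 L).domRestrict fun t => -profile p a b L S t) ∈ C1 L :=
  ⟨_, (isProfile_profile hp ha hb hL hS).contDiff.neg.contDiffOn, rfl⟩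

theorem isSimpleGeneralized (hp : 1 < p) (ha : 0 < a) (hb : 0 < b) (hL : 0 < L) (hab : a ≠ b) :
    IsSimpleGeneralized p a b L (firstEigenvalue p a b L) := by
  obtain ⟨S, C, hS⟩ := exists_isSinP hp
  refine ⟨_, domRestrict_profile_mem_C1 hp ha hb hL hS, _,
    domRestrict_neg_profile_mem_C1 hp hb ha hL hS, fun t ht => ?_, fun t ht => ?_,
    eigenSet_eq hp ha hb hL hS, not_collinear_profile hp ha hb hL hS hab⟩
  · exact (isProfile_profile hp ha hb hL hS).pos t ht
  · exact neg_neg_of_pos ((isProfile_profile hp hb ha hL hS).pos t ht)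

theorem isTwoCollinearHalfLines_iff (hp : 1 < p) (ha : 0 < a) (hb : 0 < b) (hL : 0 < L) :
    IsTwoCollinearHalfLines p a b L (firstEigenvalue p a b L) ↔ a = b := by
  obtain ⟨S, C, hS⟩ := exists_isSinP hp
  constructor
  · rintro ⟨f, -, g, -, -, -, -, hfg, hcol⟩
    by_contra hab
    rw [← hfg, eigenSet_eq hp ha hb hL hS] at hcol
    exact not_collinear_profile hp ha hb hL hS hab hcol
  · rintro rfl
    have hne := domRestrict_profile_ne_zero hp ha hb hL hS
    have hneg : ((Icc 0 L).domRestrict fun t => -profile p a a L S t) =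
      -(Icc 0 L).domRestrict (profile p a a L S) := rfl
    refine ⟨_, domRestrict_profile_mem_C1 hp ha hb hL hS, _,
      domRestrict_neg_profile_mem_C1 hp hb ha hL hS, hne, ?_, ?_, eigenSet_eq hp ha hb hL hS, ?_⟩
    · rw [hneg]
      exact neg_ne_zero.2 hne
    · intro h
      have hm : (Icc 0 L).domRestrict (profile p a a L S) ∈
          halfLine ((Icc 0 L).domRestrict (profile p a a L S)) :=
        ⟨1, one_pos, (one_smul _ _).symm⟩
      rw [h] at hm
      obtain ⟨c, hc, h1⟩ := hm
      have h2 := congrFun h1 ⟨_, Ioo_subset_Icc_self (glue_mem_Ioo ha hb hL)⟩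
      simp only [domRestrict_apply, Pi.smul_apply, smul_eq_mul, profile_glue hp ha hb hL hS] at h2
      linarith
    · rw [collinear_iff_exists_forall_eq_smul_vadd]
      refine ⟨0, (Icc 0 L).domRestrict (profile p a a L S), ?_⟩
      rintro x (⟨c, -, rfl⟩ | ⟨c, -, rfl⟩)
      · exact ⟨c, by rw [vadd_eq_add, add_zero]⟩
      · exact ⟨-c, by rw [hneg, vadd_eq_add, add_zero, smul_neg, neg_smul]⟩

end HalfLines

/-! ### Proportionality to the classical operator -/

section Multiple

variable {p a b L : ℝ}

/-- A two-valued step function. -/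
noncomputable def stepFun (s α β t : ℝ) : ℝ := if t < s then α else β

lemma integral_stepFun {s α β : ℝ} (hs : s ∈ Ioo 0 L) (g : ℝ → ℝ) :
    IntervalIntegrable (fun t => g (stepFun s α β t)) volume 0 L ∧
      ∫ t in (0 : ℝ)..L, g (stepFun s α β t) = s * g α + (L - s) * g β := by
  have e1 : ∀ᵐ t : ℝ, t ∈ uIoc 0 s → g α = g (stepFun s α β t) := by
    filter_upwards [ae_uIoc_mem_Ioo hs.1.le] with t ht htm
    simp only [stepFun]
    rw [if_pos (ht htm).2]
  have e2 : ∀ᵐ t : ℝ, t ∈ uIoc s L → g β = g (stepFun s α β t) := by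
    filter_upwards [ae_uIoc_mem_Ioo hs.2.le] with t ht htm
    simp only [stepFun]
    rw [if_neg (not_lt.2 (ht htm).1.le)]
  have i1 := (intervalIntegrable_const (a := 0) (b := s) (μ := volume) (c := g α)).congr_ae
    ((ae_restrict_iff' measurableSet_uIoc).2 e1)
  have i2 := (intervalIntegrable_const (a := s) (b := L) (μ := volume) (c := g β)).congr_ae
    ((ae_restrict_iff' measurableSet_uIoc).2 e2)
  refine ⟨i1.trans i2, ?_⟩
  rw [← intervalIntegral.integral_add_adjacent_intervals i1 i2,
    ← intervalIntegral.integral_congr_ae e1, ← intervalIntegral.integral_congr_ae e2,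
    intervalIntegral.integral_const, intervalIntegral.integral_const]
  simp

lemma memW₀_integral_stepFun {s α β : ℝ} (hs : s ∈ Ioo 0 L) (h0 : s * α + (L - s) * β = 0) :
    MemW₀ p L (fun t => ∫ r in (0 : ℝ)..t, stepFun s α β r) (stepFun s α β) := by
  have h := integral_stepFun (α := α) (β := β) hs id
  refine IsPrimitive.memW₀ (by linarith [hs.1, hs.2]) ⟨h.1, fun _ _ => rfl⟩ (h.2.trans h0) ?_
  refine MemLp.of_bound (C := max |α| |β|) ?_ (Filter.Eventually.of_forall fun t => ?_)
  · exact (Measurable.ite measurableSet_Iio measurable_const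
      measurable_const).aestronglyMeasurable
  · unfold stepFun
    split_ifs
    · exact le_max_left _ _
    · exact le_max_right _ _

/-- Testing a piecewise linear function against itself turns proportionality of the operators into
proportionality of the energies. -/
theorem isMultipleOfClassical_iff (hp : 1 < p) (ha : 0 < a) (hb : 0 < b) (hL : 0 < L) :
    IsMultipleOfClassical p a b L ↔ a = b := by
  constructor
  · rintro ⟨k, hk⟩
    have key : ∀ {s α β : ℝ}, s ∈ Ioo 0 L → s * α + (L - s) * β = 0 →
        s * energy p a b α + (L - s) * energy p a b β = k * (s * |α| ^ p + (L - s) * |β| ^ p) := by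
      intro s α β hs h0
      have hm := memW₀_integral_stepFun (p := p) hs h0
      have h := hk _ _ _ _ hm hm
      simp only [classicalFlux_eq hp, flux_mul_self hp, energy_one_one hp] at h
      rwa [setIntegral_Ioo_eq hL.le, setIntegral_Ioo_eq hL.le,
        (integral_stepFun hs (energy p a b)).2, (integral_stepFun hs fun x => |x| ^ p).2] at h
    -- The two tent functions are mirror images up to exchanging slopes `2, -1` with `1, -2`. Their
    -- classical energies agree, so subtraction eliminates `k` and leaves `(2 ^ p - 2) * (a ^ p - b
    -- ^ p) = 0`.
    have h1 := key (s := L / 3) (α := 2) (β := -1) ⟨by linarith, by linarith⟩ (by ring)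
    have h2 := key (s := 2 * L / 3) (α := 1) (β := -2) ⟨by linarith, by linarith⟩ (by ring)
    rw [energy_neg, energy_of_nonneg hp (by norm_num), energy_of_nonneg hp (by norm_num), abs_neg,
      abs_one, abs_of_pos two_pos, Real.one_rpow] at h1
    rw [energy_neg, energy_of_nonneg hp (by norm_num), energy_of_nonneg hp (by norm_num), abs_neg,
      abs_one, abs_of_pos two_pos, Real.one_rpow] at h2
    have h2p : (2 : ℝ) < 2 ^ p := by
      have := Real.rpow_lt_rpow_of_exponent_lt one_lt_two hp
      rwa [Real.rpow_one] at this
    have h3 : L / 3 * (2 ^ p - 2) * (a ^ p - b ^ p) = 0 := by linear_combination h1 - h2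
    have h4 : L / 3 * ((2 : ℝ) ^ p - 2) ≠ 0 := (mul_pos (by positivity) (by linarith)).ne'
    have h5 := sub_eq_zero.1 ((mul_eq_zero.1 h3).resolve_left h4)
    exact (Real.rpow_left_inj ha.le hb.le (by linarith)).1 h5
  · rintro rfl
    refine ⟨a ^ p, fun u v φ ψ _ _ => ?_⟩
    simp only [flux_self hp, mul_assoc, integral_const_mul]

end Multiple

end AsymPLaplace

/-! ### The main theorem -/

theorem theorem1 (p a b L : ℝ) (hp : 1 < p) (ha : 0 < a) (hb : 0 < b) (hL : 0 < L) :
    -- the explicit value of the classical first eigenvalue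
    classicalFirstEigenvalue p L = (p - 1) * (piP p / L) ^ p ∧
    -- (I), and the number in question is the smallest Dirichlet eigenvalue
    firstEigenvalue p a b L = ((a + b) / 2) ^ p * classicalFirstEigenvalue p L ∧
    IsLeast (dirichletSpectrum p a b L) (firstEigenvalue p a b L) ∧
    -- the normalized principal eigenfunction exists and is unique
    (∃ φ : ℝ → ℝ, IsPrincipalEigenfunction p φ) ∧
    (∀ φ φ' : ℝ → ℝ, IsPrincipalEigenfunction p φ → IsPrincipalEigenfunction p φ' →
      EqOn φ φ' (Icc 0 1)) ∧
    -- (II)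
    (∀ φ : ℝ → ℝ, IsPrincipalEigenfunction p φ → ∀ u : ℝ → ℝ,
      IsEigenfunction p a b L (firstEigenvalue p a b L) u ↔
        ∃ c : ℝ, 0 < c ∧
          ((∀ t ∈ Icc 0 L, u t = c * phiPlus a b φ (t / L)) ∨
            (∀ t ∈ Icc 0 L, u t = c * phiMinus a b φ (t / L)))) ∧
    -- generalized simplicity and collinearity
    (a ≠ b → IsSimpleGeneralized p a b L (firstEigenvalue p a b L)) ∧
    (IsTwoCollinearHalfLines p a b L (firstEigenvalue p a b L) ↔ a = b) ∧
    (IsTwoCollinearHalfLines p a b L (firstEigenvalue p a b L) ↔ IsMultipleOfClassical p a b L) := by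
  have hpow : ((a + b) / 2) ^ p * classicalFirstEigenvalue p L = firstEigenvalue p a b L := by
    rw [classicalFirstEigenvalue_eq hp, firstEigenvalue_eq hp one_pos one_pos hL, lamValue_one_one,
      firstEigenvalue_eq hp ha hb hL, lamValue]
  refine ⟨?_, hpow.symm, ?_, exists_isPrincipalEigenfunction hp,
    fun φ φ' hφ hφ' => hφ.eqOn hp hφ',
    fun φ hφ u => isEigenfunction_iff_phi hp ha hb hL hφ u,
    isSimpleGeneralized hp ha hb hL, isTwoCollinearHalfLines_iff hp ha hb hL, ?_⟩
  · rw [classicalFirstEigenvalue_eq hp, firstEigenvalue_eq hp one_pos one_pos hL, lamValue_one_one]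
  · obtain ⟨S, C, hS⟩ := exists_isSinP hp
    rw [firstEigenvalue_eq hp ha hb hL]
    exact isLeast_dirichletSpectrum hp ha hb hL (isProfile_profile hp ha hb hL hS)
      (isProfile_profile_swap hp ha hb hL hS)
  · rw [isTwoCollinearHalfLines_iff hp ha hb hL, isMultipleOfClassical_iff hp ha hb hL]
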